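/- \textbf{Theorem (Class DIII).} Let $\mathcal H$ be a complex Hilbert space of finite dimension $N$ and $\mathbb T^d=\mathbb R^d/\mathbb Z^d$. A \emph{DIII pair} $(T,C)$ consists of anti-unitary operators on $\mathcal H$ with $T^2=-1$, $C^2=1$ and $(TC)^2=1$. For such a pair let ${\rm DIII}(d,n,N)$ be the set of continuous maps $P$ from $\mathbb T^d$ to the rank-$n$ orthogonal projections on $\mathcal H$ such that $T^{-1}P(k)T=P(-k)$ and $C^{-1}P(k)C=1-P(-k)$ for all $k$, with the compact-open (uniform) topology; $P_0,P_1$ are \emph{homotopic} in it if they are joined by a continuous path inside ${\rm DIII}(d,n,N)$. Let $J=J_{2m}=\begin{pmatrix}0&1_m\\-1_m&0\end{pmatrix}$, let $K$ be complex conjugation of coordinates, and let ${\rm Sp}(m)=\{U\in {\rm U}(2m): U^TJU=J\}$. \begin{enumerate} \item Let $d,n\ge 0$. For every DIII pair on $\mathcal H$, the set ${\rm DIII}(d,n,N)$ is non-empty if and only if there is an integer $m\ge0$ with $n=2m$ and $N=4m$. Likewise, there exists a DIII pair on $\mathcal H$ with ${\rm DIII}(d,n,N)\neq\emptyset$ if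 and only if there is such an $m$. \end{enumerate} Now let $N=4m$ and fix a DIII pair. There is an orthonormal basis of $\mathcal H$ in which \[ T=\begin{pmatrix}0&KJ\\KJ&0\end{pmatrix},\qquad C=\begin{pmatrix}0&KJ\\-KJ&0\end{pmatrix}. \] In such a basis every $P\in{\rm DIII}(d,2m,4m)$ has the form $P(k)=\frac12\begin{pmatrix}1&Q(k)\\Q(k)^*&1\end{pmatrix}$ with $Q(k)\in{\rm U}(2m)$; put $A(k)=J^TQ(k)$. \begin{enumerate} \item[2.] ${\rm DIII}(0,2m,4m)$ is path-connected. For each such basis there is a homeomorphism from the space ${\rm U}(2m)/{\rm Sp}(m)$ of left cosets onto ${\rm DIII}(0,2m,4m)$ that sends the class of $V$ to the projection with $A=(V^{-1})^TJV^{-1}$. \item[3.] There is a map ${\rm Index}\colon{\rm DIII}(1,2m,4m)\to\{\pm1\}$ with the following properties. For each such basis and each $P$, there is a continuous $\alpha\colon[0,\frac12]\to\mathbb R$ with $\det A(k)=e^{i\alpha(k)}$ on $[0,\frac12]$, and for every such $\alpha$ \[ {\rm Index}(P)=\frac{e^{\frac i2\alpha(0)}}{{\rm Pf}\,A(0)}\cdot\frac{e^{\frac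 i2\alpha(\frac12)}}{{\rm Pf}\,A(\frac12)}. \] Moreover, $P_0,P_1$ are homotopic in ${\rm DIII}(1,2m,4m)$ if and only if ${\rm Index}(P_0)={\rm Index}(P_1)$. \end{enumerate} -/

import Mathlib

open scoped Matrix

noncomputable section

namespace ClassDIII

/-! ### Symmetries and the spaces of symmetric families of projections -/

section Spaces

variable {H : Type*} [NormedAddCommGroup H] [InnerProductSpace ℂ H]

/-- The `d`-dimensional torus `ℝ^d / ℤ^d`. -/
abbrev Torus (d : ℕ) : Type := Fin d → UnitAddCircle

/-- The Grassmannian of rank `n` orthogonal projections: `P ^ 2 = P = P ^ *`, `Tr P = n`. -/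
def grassmannian (H : Type*) [NormedAddCommGroup H] [InnerProductSpace ℂ H] (n : ℕ) :
    Set (H →L[ℂ] H) :=
  {P | P * P = P ∧ (P : H →ₗ[ℂ] H).IsSymmetric ∧ LinearMap.trace ℂ H (P : H →ₗ[ℂ] H) = (n : ℂ)}

/-- The symmetry operators of class DIII. Antiunitary operators are conjugate-linear isometric
bijections. The operator `T` is odd, the operator `C` is even, and `S = T C` (which is automatically
unitary) satisfies `S ^ 2 = 1`. -/
structure IsDIIIPair (T C : H ≃ₗᵢ⋆[ℂ] H) : Prop where
  T_odd : ∀ x, T (T x) = -x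
  C_even : ∀ x, C (C x) = x
  TC_sq : ∀ x, T (C (T (C x))) = x

/-- The set `DIII(d, n, N)`, where `N = dim H`: continuous maps from the torus to the Grassmannian
with `T⁻¹ P(k) T = P(-k)` and `C⁻¹ P(k) C = 1 - P(-k)`. As a subset of the space of continuous
maps it carries the compact-open topology. (Both symmetries together imply the chiral symmetry
`S⁻¹ P(k) S = 1 - P(k)` for `S = T C`.) -/
def DIII (T C : H ≃ₗᵢ⋆[ℂ] H) (d n : ℕ) : Set C(Torus d, H →L[ℂ] H) :=
  {P | (∀ k, P k ∈ grassmannian H n) ∧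
    (∀ k x, T.symm (P k (T x)) = P (-k) x) ∧
    (∀ k x, C.symm (P k (C x)) = x - P (-k) x)}

end Spaces

/-! ### Matrices -/

/-- The symplectic matrix `J_{2m}`, with rows `(0, 1)` and `(-1, 0)`. -/
def J (m : ℕ) : Matrix (Fin m ⊕ Fin m) (Fin m ⊕ Fin m) ℂ :=
  Matrix.fromBlocks 0 1 (-1) 0

/-- The unitary group `U(2m)`, with the `2m` indices cut into two blocks of length `m`. -/
abbrev U (m : ℕ) : Type := Matrix.unitaryGroup (Fin m ⊕ Fin m) ℂ

/-- The compact symplectic group `Sp(m) = {V ∈ U(2m) | Vᵀ J V = J}`. -/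
def Sp (m : ℕ) : Subgroup (U m) where
  carrier := {V | (V : Matrix (Fin m ⊕ Fin m) (Fin m ⊕ Fin m) ℂ)ᵀ * J m *
    (V : Matrix (Fin m ⊕ Fin m) (Fin m ⊕ Fin m) ℂ) = J m}
  one_mem' := by simp
  mul_mem' := by
    intro V W hV hW
    simp only [Set.mem_ofPred_eq] at hV hW ⊢
    rw [Submonoid.coe_mul, Matrix.transpose_mul]
    calc _ = (W : Matrix (Fin m ⊕ Fin m) (Fin m ⊕ Fin m) ℂ)ᵀ *
          ((V : Matrix (Fin m ⊕ Fin m) (Fin m ⊕ Fin m) ℂ)ᵀ * J m *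
          (V : Matrix (Fin m ⊕ Fin m) (Fin m ⊕ Fin m) ℂ)) *
          (W : Matrix (Fin m ⊕ Fin m) (Fin m ⊕ Fin m) ℂ) := by simp only [Matrix.mul_assoc]
      _ = J m := by rw [hV, hW]
  inv_mem' := by
    intro V hV
    simp only [Set.mem_ofPred_eq] at hV ⊢
    have h1 : (V : Matrix (Fin m ⊕ Fin m) (Fin m ⊕ Fin m) ℂ) *
        ((V⁻¹ : U m) : Matrix (Fin m ⊕ Fin m) (Fin m ⊕ Fin m) ℂ) = 1 := by
      rw [← Submonoid.coe_mul, mul_inv_cancel, Submonoid.coe_one]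
    have h2 : ((V⁻¹ : U m) : Matrix (Fin m ⊕ Fin m) (Fin m ⊕ Fin m) ℂ)ᵀ *
        (V : Matrix (Fin m ⊕ Fin m) (Fin m ⊕ Fin m) ℂ)ᵀ = 1 := by
      rw [← Matrix.transpose_mul, h1, Matrix.transpose_one]
    conv_lhs => rw [← hV]
    calc _ = (((V⁻¹ : U m) : Matrix (Fin m ⊕ Fin m) (Fin m ⊕ Fin m) ℂ)ᵀ *
          (V : Matrix (Fin m ⊕ Fin m) (Fin m ⊕ Fin m) ℂ)ᵀ) * J m *
          ((V : Matrix (Fin m ⊕ Fin m) (Fin m ⊕ Fin m) ℂ) *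
          ((V⁻¹ : U m) : Matrix (Fin m ⊕ Fin m) (Fin m ⊕ Fin m) ℂ)) := by
            simp only [Matrix.mul_assoc]
      _ = J m := by rw [h1, h2, Matrix.one_mul, Matrix.mul_one]

/-- The Pfaffian of a `2m × 2m` matrix (used for antisymmetric matrices only):
`(2^m m!)⁻¹ ∑_σ sgn(σ) ∏_{i < m} A_{σ(2i), σ(2i+1)}`, the indices running from `0` to `2m - 1`. -/
def pfaffianFin (m : ℕ) (A : Matrix (Fin (2 * m)) (Fin (2 * m)) ℂ) : ℂ :=
  ((2 ^ m * m.factorial : ℕ) : ℂ)⁻¹ * ∑ σ : Equiv.Perm (Fin (2 * m)),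
    ((Equiv.Perm.sign σ : ℤ) : ℂ) *
      ∏ i : Fin m, A (σ ⟨2 * i, by omega⟩) (σ ⟨2 * i + 1, by omega⟩)

/-- The Pfaffian of a `2m × 2m` matrix in two blocks of length `m`, the indices of the first block
preceding those of the second. -/
def pfaffian {m : ℕ} (A : Matrix (Fin m ⊕ Fin m) (Fin m ⊕ Fin m) ℂ) : ℂ :=
  pfaffianFin m
    (Matrix.reindex (finSumFinEquiv.trans (finCongr (two_mul m).symm))
      (finSumFinEquiv.trans (finCongr (two_mul m).symm)) A)

/-! ### The normal form and the matrices `Q(k)` and `A(k)` -/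

section NormalForm

variable {H : Type*} [NormedAddCommGroup H] [InnerProductSpace ℂ H]

/-- Indices of the basis vectors of a `4m`-dimensional space: two blocks of length `2m`, each of
which is cut into two blocks of length `m`. -/
abbrev Idx (m : ℕ) : Type := (Fin m ⊕ Fin m) ⊕ (Fin m ⊕ Fin m)

/-- In the basis `b` the conjugate-linear operator `T` is `x ↦ M (conj x)`, that is `M K`, where
`K` is complex conjugation of the coordinates. -/
def HasAntilinearMatrix {ι : Type*} [Fintype ι] (b : OrthonormalBasis ι ℂ H)
    (T : H ≃ₗᵢ⋆[ℂ] H) (M : Matrix ι ι ℂ) : Prop :=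
  ∀ j, T (b j) = ∑ i, M i j • b i

/-- The orthonormal basis `b` puts `T` and `C` into the normal form
`T = [0, K J; K J, 0]`, `C = [0, K J; -K J, 0]`, so that `T C = [1, 0; 0, -1]`.
(As `J` is real, `K J = J K`.) -/
structure IsNormalBasis {m : ℕ} (T C : H ≃ₗᵢ⋆[ℂ] H) (b : OrthonormalBasis (Idx m) ℂ H) :
    Prop where
  T_form : HasAntilinearMatrix b T (Matrix.fromBlocks 0 (J m) (J m) 0)
  C_form : HasAntilinearMatrix b C (Matrix.fromBlocks 0 (J m) (-J m) 0)

/-- The matrix `Q` for which the matrix of `P` in the basis `b` is `½ [1, Q; Q^*, 1]`,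
read off as twice the upper right block. -/
def matQ {m : ℕ} (b : OrthonormalBasis (Idx m) ℂ H) (P : H →L[ℂ] H) :
    Matrix (Fin m ⊕ Fin m) (Fin m ⊕ Fin m) ℂ :=
  (2 : ℂ) • (LinearMap.toMatrix b.toBasis b.toBasis (P : H →ₗ[ℂ] H)).toBlocks₁₂

/-- The matrix `A = Jᵀ Q`. -/
def matA {m : ℕ} (b : OrthonormalBasis (Idx m) ℂ H) (P : H →L[ℂ] H) :
    Matrix (Fin m ⊕ Fin m) (Fin m ⊕ Fin m) ℂ :=
  (J m)ᵀ * matQ b P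

/-- The point of the circle `Torus 1 = ℝ / ℤ` given by a real number. -/
def pt (k : ℝ) : Torus 1 := fun _ => (k : UnitAddCircle)

/-- `α` is a continuous phase of `det A(k)` on `[0, 1/2]`: `det A(k) = exp (i α(k))`. -/
def IsPhase {m : ℕ} (b : OrthonormalBasis (Idx m) ℂ H) (P : C(Torus 1, H →L[ℂ] H))
    (α : ℝ → ℝ) : Prop :=
  ContinuousOn α (Set.Icc 0 (1 / 2)) ∧
    ∀ k ∈ Set.Icc (0 : ℝ) (1 / 2),
      (matA b (P (pt k))).det = Complex.exp (Complex.I * (α k : ℂ))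

/-- `exp (i α(0) / 2) / Pf A(0) * exp (i α(1/2) / 2) / Pf A(1/2)`. -/
def indexFormula {m : ℕ} (b : OrthonormalBasis (Idx m) ℂ H) (P : C(Torus 1, H →L[ℂ] H))
    (α : ℝ → ℝ) : ℂ :=
  Complex.exp (Complex.I * (α 0 : ℂ) / 2) / pfaffian (matA b (P (pt 0))) *
    (Complex.exp (Complex.I * (α (1 / 2) : ℂ) / 2) / pfaffian (matA b (P (pt (1 / 2)))))

end NormalForm

end ClassDIII

end

/-! In a normal basis the chiral symmetry `TC` is `diag(1, -1)`. It turns a projection of the family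
into its complement, so the diagonal blocks equal 1/2, and idempotency makes `Q` unitary. For `A =
Jᵀ Q` the symmetry `T` reads `A(-k) = -A(k)ᵀ`, and `C` then holds automatically (`mem_DIII_iff`).
Hence the class is homeomorphic to the space of families of unitaries with `A(-k) = -A(k)ᵀ`
(`homeoSymFam`). The dimension condition is seen at `k = 0`: by `C` the trace of `P(0)` is `N/2`,
and `T` is an odd antiunitary on the range of `P(0)`, whose dimension is therefore even.

For `d = 0` the matrix `A` is antisymmetric. A square root of `J⁻¹A` that is a polynomial in `J⁻¹A`
gives `A = VᵀJV` (`exists_eq_transpose_mul_J_mul`). So `U(2m)` acts transitively by congruence, with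
`Sp(m)` as the stabilizer of `J`, and connectedness comes from that of `U(2m)`.

For `d = 1` the loop is determined by its restriction to `[0, 1/2]`, whose end points are
antisymmetric. The congruences `W(-k)ᵀ A(k) W(k)` preserve the symmetry. With `W` null-homotopic
they give a homotopy that brings both end points to `J`; what remains is an arbitrary loop `β` in
`U(2m)` (`exists_eq_double`). Loops in `U(2m)` are classified by the winding number `w` of the
determinant: a column can be moved to a multiple of a basis vector, and induction on the size leaves
a single diagonal entry (`exists_joined_diagLoop`). A congruence by a null-homotopic `W` that is 1
at both end points can change `w` by any even number, so only its parity may survive.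

It does survive: the index formula equals `(-1)^w` (`loopIndex_double`). Its square is 1 because
`Pf² = det`, and it varies continuously with a lifted phase, so it is a homotopy invariant. Another
normal basis changes `A` by a constant congruence, which is a homotopy as `U(2m)` is connected; so
the index does not depend on the basis. -/

noncomputable section

namespace ClassDIII

/-! ### Paths, square roots and compactness in the unitary group -/

section UnitaryGroup

open scoped Matrix.Norms.L2Operator

variable {n : Type*} [Fintype n] [DecidableEq n]

/-- A unitary with a continuous argument on its spectrum is the exponential of a skew-adjoint
element. -/
theorem expUnitary_argSelfAdjoint_of_continuousOn {A : Type*} [CStarAlgebra A] (u : unitary A)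
    (h : ContinuousOn Complex.arg (spectrum ℂ (u : A))) :
    selfAdjoint.expUnitary (Unitary.argSelfAdjoint u) = u := by
  ext
  rw [selfAdjoint.expUnitary_coe, Unitary.argSelfAdjoint_coe,
    ← CFC.exp_eq_normedSpace_exp (𝕜 := ℂ), ← cfc_comp_smul .., ← cfc_comp' ..]
  conv_rhs => rw [← cfc_id' ℂ (u : A)]
  refine cfc_congr fun y hy ↦ ?_
  have hy₁ : ‖y‖ = 1 := spectrum.norm_eq_one_of_unitary u.2 hy
  have : Complex.I * y.arg = Complex.log y :=
    Complex.ext (by simp [Complex.log_re, hy₁]) (by simp [Complex.log_im])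
  simpa [← Complex.exp_eq_exp_ℂ, this] using Complex.exp_log (by rintro rfl; simp at hy₁)

/-- Every unitary matrix is the exponential of a skew-adjoint matrix. -/
theorem expUnitary_argSelfAdjoint_matrix (u : unitary (Matrix n n ℂ)) :
    selfAdjoint.expUnitary (Unitary.argSelfAdjoint u) = u :=
  expUnitary_argSelfAdjoint_of_continuousOn u ((Matrix.finite_spectrum _).continuousOn _)

/-- Scaling the self-adjoint logarithm to 0 gives a path to 1. -/
theorem joined_unitaryGroup (u v : Matrix.unitaryGroup n ℂ) : Joined u v := by
  have h (w : unitary (Matrix n n ℂ)) : Joined 1 w := by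
    rw [← expUnitary_argSelfAdjoint_matrix w]
    exact selfAdjoint.joined_one_expUnitary _
  exact (h u).symm.trans (h v)

/-- A unitary matrix has a unitary square root which is a polynomial in the matrix. -/
theorem exists_sqrt_unitary (u : Matrix.unitaryGroup n ℂ) :
    ∃ q : Polynomial ℂ, Polynomial.aeval (u : Matrix n n ℂ) q ∈ Matrix.unitaryGroup n ℂ ∧
      Polynomial.aeval (u : Matrix n n ℂ) q * Polynomial.aeval (u : Matrix n n ℂ) q = u := by
  have hfin : (spectrum ℂ (u : Matrix n n ℂ)).Finite := Matrix.finite_spectrum _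
  set f : ℂ → ℂ := fun z => z ^ (1 / 2 : ℂ) with hf
  -- The spectrum is finite, so the branch cut of the square root does no harm, and interpolation at
  -- the eigenvalues makes the functional calculus polynomial.
  have hc (g : ℂ → ℂ) : ContinuousOn g (spectrum ℂ (u : Matrix n n ℂ)) := hfin.continuousOn _
  refine ⟨Lagrange.interpolate hfin.toFinset id f, ?_⟩
  have hu : IsStarNormal (u : Matrix n n ℂ) := inferInstance
  have h : Polynomial.aeval (u : Matrix n n ℂ) (Lagrange.interpolate hfin.toFinset id f) =
      cfc f (u : Matrix n n ℂ) := by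
    rw [← cfc_polynomial _ (u : Matrix n n ℂ)]
    refine cfc_congr fun y hy => ?_
    exact Lagrange.eval_interpolate_at_node (v := id) f Function.injective_id.injOn (by simpa using hy)
  rw [h]
  constructor
  · refine (cfc_unitary_iff f (u : Matrix n n ℂ) hu (hc _)).2 fun y hy => ?_
    have hy₁ : ‖y‖ = 1 := spectrum.norm_eq_one_of_unitary u.2 hy
    have : ‖f y‖ = 1 := by
      have h2 : f y ^ 2 = y := by simp [hf]
      have h3 : ‖f y‖ ^ 2 = 1 := by rw [← norm_pow, h2, hy₁]
      exact (pow_eq_one_iff_of_nonneg (norm_nonneg _) two_ne_zero).1 h3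
    have h2 := Complex.conj_mul' (f y)
    simpa [this] using h2
  · rw [← cfc_mul _ _ (u : Matrix n n ℂ) (hc _) (hc _)]
    conv_rhs => rw [← cfc_id' ℂ (u : Matrix n n ℂ)]
    refine cfc_congr fun y hy => ?_
    simp [hf, ← pow_two]

end UnitaryGroup

/-- A closed subset of a product of unit discs. Compactness later makes the bijection from
`U(2m)/Sp(m)` a homeomorphism. -/
theorem isCompact_unitaryGroup (n : Type*) [Fintype n] [DecidableEq n] :
    IsCompact (Matrix.unitaryGroup n ℂ : Set (Matrix n n ℂ)) := by
  have hcl : IsClosed (Matrix.unitaryGroup n ℂ : Set (Matrix n n ℂ)) := by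
    have : (Matrix.unitaryGroup n ℂ : Set (Matrix n n ℂ)) = {A | A * star A = 1} := by
      ext A; exact Matrix.mem_unitaryGroup_iff
    rw [this]
    exact isClosed_eq (by fun_prop) continuous_const
  have : IsCompact (Set.pi Set.univ fun _ : n => Set.pi Set.univ fun _ : n =>
      Metric.closedBall (0 : ℂ) 1) :=
    isCompact_univ_pi fun _ => isCompact_univ_pi fun _ => isCompact_closedBall _ _
  refine this.of_isClosed_subset hcl fun A hA i _ j _ => ?_
  simpa using entry_norm_bound_of_unitary hA i j

instance (n : Type*) [Fintype n] [DecidableEq n] : CompactSpace (Matrix.unitaryGroup n ℂ) :=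
  isCompact_iff_compactSpace.1 (isCompact_unitaryGroup n)


/-! ### The matrix `J` and antisymmetric unitaries -/

theorem J_mul_J (m : ℕ) : J m * J m = -1 := by
  simp [J, Matrix.fromBlocks_multiply, ← Matrix.fromBlocks_one, Matrix.fromBlocks_neg]

theorem J_transpose (m : ℕ) : (J m)ᵀ = -J m := by
  simp [J, Matrix.fromBlocks_transpose, Matrix.fromBlocks_neg]

theorem J_conjTranspose (m : ℕ) : (J m)ᴴ = -J m := by
  simp [J, Matrix.fromBlocks_conjTranspose, Matrix.fromBlocks_neg]

theorem J_map_star (m : ℕ) : (J m).map star = J m := by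
  rw [J, Matrix.fromBlocks_map]
  congr 1 <;> ext i j <;> simp [Matrix.one_apply, apply_ite]

theorem J_mem_unitary (m : ℕ) : J m ∈ Matrix.unitaryGroup (Fin m ⊕ Fin m) ℂ := by
  rw [Matrix.mem_unitaryGroup_iff, Matrix.star_eq_conjTranspose, J_conjTranspose]
  simp [J_mul_J]

/-- An antisymmetric unitary matrix is congruent to `J`. -/
theorem exists_eq_transpose_mul_J_mul {m : ℕ} {A : Matrix (Fin m ⊕ Fin m) (Fin m ⊕ Fin m) ℂ}
    (hA : A ∈ Matrix.unitaryGroup (Fin m ⊕ Fin m) ℂ) (hA' : Aᵀ = -A) :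
    ∃ V : U m, (V : Matrix (Fin m ⊕ Fin m) (Fin m ⊕ Fin m) ℂ)ᵀ * J m *
      (V : Matrix (Fin m ⊕ Fin m) (Fin m ⊕ Fin m) ℂ) = A := by
  -- `B = J⁻¹A`. If `V² = B` and `VᵀJ = JV`, then `VᵀJV = JV² = A`. The second relation is the
  -- reason for a polynomial square root.
  set B : U m := ⟨J m, J_mem_unitary m⟩⁻¹ * ⟨A, hA⟩ with hB
  have hBc : (B : Matrix (Fin m ⊕ Fin m) (Fin m ⊕ Fin m) ℂ) = -(J m * A) := by
    rw [hB, Submonoid.coe_mul, Matrix.UnitaryGroup.inv_val, Matrix.star_eq_conjTranspose,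
      J_conjTranspose, Matrix.neg_mul]
  obtain ⟨q, hq, hq2⟩ := exists_sqrt_unitary B
  rw [hBc] at hq hq2
  -- Antisymmetry of `A` gives the relation for `B` itself; powers and linear combinations inherit
  -- it.
  have key (q : Polynomial ℂ) : (Polynomial.aeval (-(J m * A)) q)ᵀ * J m =
      J m * Polynomial.aeval (-(J m * A)) q := by
    induction q using Polynomial.induction_on' with
    | add p q hp hq => simp [Matrix.add_mul, Matrix.mul_add, hp, hq]
    | monomial k a =>
      have (k : ℕ) : ((-(J m * A)) ^ k)ᵀ * J m = J m * (-(J m * A)) ^ k := by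
        induction k with
        | zero => simp
        | succ k ih =>
          rw [pow_succ', Matrix.transpose_mul, Matrix.mul_assoc]
          have : (-(J m * A))ᵀ * J m = J m * (-(J m * A)) := by
            rw [Matrix.transpose_neg, Matrix.transpose_mul, hA', J_transpose]
            simp only [Matrix.neg_mul, Matrix.mul_neg, neg_neg, Matrix.mul_assoc, J_mul_J]
            rw [← Matrix.mul_assoc, J_mul_J]
            simp
          rw [this, ← Matrix.mul_assoc, ih, Matrix.mul_assoc, ← pow_succ, pow_succ']
      rw [Polynomial.aeval_monomial, ← Algebra.smul_def, Matrix.transpose_smul, Matrix.smul_mul,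
        this, Matrix.mul_smul]
  refine ⟨⟨_, hq⟩, ?_⟩
  rw [key, Matrix.mul_assoc, hq2, Matrix.mul_neg, ← Matrix.mul_assoc, J_mul_J]
  simp

/-! ### The Pfaffian under congruence, and its value at `J` -/

section Pfaffian

/-- The indices `2i` and `2i + 1` in `Fin (2 * m)` as pairs. -/
def pairEquiv (m : ℕ) : Fin m × Fin 2 ≃ Fin (2 * m) :=
  finProdFinEquiv.trans (finCongr (mul_comm m 2))

theorem pairEquiv_zero {m : ℕ} (i : Fin m) : pairEquiv m (i, 0) = ⟨2 * i, by omega⟩ := by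
  ext; simp [pairEquiv]

theorem pairEquiv_one {m : ℕ} (i : Fin m) : pairEquiv m (i, 1) = ⟨2 * i + 1, by omega⟩ := by
  ext; simp [pairEquiv]; omega

/-- The Pfaffian sum, without its normalization. -/
def pfaffianSum {m : ℕ} {κ : Type*} [Fintype κ] [DecidableEq κ] (e : Fin m × Fin 2 ≃ κ)
    (A : Matrix κ κ ℂ) : ℂ :=
  ∑ σ : Equiv.Perm κ, ((Equiv.Perm.sign σ : ℤ) : ℂ) * ∏ i : Fin m, A (σ (e (i, 0))) (σ (e (i, 1)))

theorem pfaffianFin_eq (m : ℕ) (A : Matrix (Fin (2 * m)) (Fin (2 * m)) ℂ) :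
    pfaffianFin m A = ((2 ^ m * m.factorial : ℕ) : ℂ)⁻¹ * pfaffianSum (pairEquiv m) A := by
  simp only [pfaffianFin, pfaffianSum, pairEquiv_zero, pairEquiv_one]

theorem pfaffianSum_reindex {m : ℕ} {κ ι : Type*} [Fintype κ] [DecidableEq κ] [Fintype ι]
    [DecidableEq ι] (e : Fin m × Fin 2 ≃ κ) (f : ι ≃ κ) (A : Matrix ι ι ℂ) :
    pfaffianSum e (Matrix.reindex f f A) = pfaffianSum (e.trans f.symm) A := by
  unfold pfaffianSum
  refine Fintype.sum_equiv f.symm.permCongr _ _ fun σ => ?_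
  simp [Equiv.permCongr_apply]

/-- The order in which the indices are listed affects the Pfaffian by a sign only. -/
theorem pfaffianSum_trans {m : ℕ} {κ : Type*} [Fintype κ] [DecidableEq κ]
    (e : Fin m × Fin 2 ≃ κ) (τ : Equiv.Perm κ) (A : Matrix κ κ ℂ) :
    pfaffianSum (e.trans τ) A = ((Equiv.Perm.sign τ : ℤ) : ℂ) * pfaffianSum e A := by
  unfold pfaffianSum
  rw [Finset.mul_sum]
  refine Fintype.sum_equiv (Equiv.mulRight τ) _ _ fun σ => ?_
  have : ((Equiv.Perm.sign τ : ℤ) : ℂ) * ((Equiv.Perm.sign τ : ℤ) : ℂ) = 1 := by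
    rw [← Int.cast_mul, ← Units.val_mul, Int.units_mul_self]; simp
  simp only [Equiv.coe_mulRight, Equiv.Perm.sign_mul, Units.val_mul, Int.cast_mul,
    Equiv.trans_apply, Equiv.Perm.mul_apply]
  linear_combination (-(((Equiv.Perm.sign σ : ℤ) : ℂ) *
    ∏ i : Fin m, A (σ (τ (e (i, 0)))) (σ (τ (e (i, 1)))))) * this

/-- The Pfaffian sum of a congruent matrix. -/
theorem pfaffianSum_transpose_mul_mul {m : ℕ} {κ : Type*} [Fintype κ] [DecidableEq κ]
    (e : Fin m × Fin 2 ≃ κ) (W A : Matrix κ κ ℂ) :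
    pfaffianSum e (Wᵀ * A * W) = W.det * pfaffianSum e A := by
  have h1 (a b : κ) : (Wᵀ * A * W) a b = ∑ p : κ × κ, W p.1 a * A p.1 p.2 * W p.2 b := by
    simp only [Matrix.mul_apply, Matrix.transpose_apply, Fintype.sum_prod_type, Finset.sum_mul]
    rw [Finset.sum_comm]
  let F : (Fin m → κ × κ) ≃ (κ → κ) :=
    { toFun := fun f k => if (e.symm k).2 = 0 then (f (e.symm k).1).1 else (f (e.symm k).1).2
      invFun := fun g i => (g (e (i, 0)), g (e (i, 1)))
      left_inv := fun f => by ext i <;> simp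
      right_inv := fun g => by
        ext k
        obtain ⟨⟨i, c⟩, rfl⟩ := e.surjective k
        fin_cases c <;> simp }
  -- Expanding the entries gives two new indices per pair, which `F` collects into one map `g`. For
  -- fixed `g` the signed sum over permutations is the determinant of `W` with rows chosen by `g`,
  -- as in the proof of multiplicativity of the determinant.
  have h2 : pfaffianSum e (Wᵀ * A * W) = ∑ g : κ → κ,
      (∏ i : Fin m, A (g (e (i, 0))) (g (e (i, 1)))) * (W.submatrix g id).det := by
    simp only [pfaffianSum, h1, Finset.prod_univ_sum, Fintype.piFinset_univ, Finset.mul_sum]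
    rw [Finset.sum_comm]
    refine Fintype.sum_equiv F _ _ fun f => ?_
    rw [← Matrix.det_transpose, Matrix.det_apply', Finset.mul_sum]
    refine Finset.sum_congr rfl fun σ _ => ?_
    have h3 : ∏ k : κ, (W.submatrix (F f) id)ᵀ (σ k) k =
        (∏ i : Fin m, W (f i).1 (σ (e (i, 0)))) * ∏ i : Fin m, W (f i).2 (σ (e (i, 1))) := by
      rw [← e.prod_comp, Fintype.prod_prod_type, ← Finset.prod_mul_distrib]
      refine Finset.prod_congr rfl fun i _ => ?_
      rw [Fin.prod_univ_two]
      simp [F]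
    rw [h3]
    simp only [Finset.prod_mul_distrib]
    simp [F]
    ring
  rw [h2]
  -- Only permutations `g` survive, since otherwise a row is repeated.
  have h4 : ∀ g : κ → κ, ¬ Function.Bijective g → (W.submatrix g id).det = 0 := by
    intro g hg
    have : ¬ Function.Injective g := fun h => hg (Finite.injective_iff_bijective.1 h)
    simp only [Function.Injective, not_forall] at this
    obtain ⟨a, b, hab, hne⟩ := this
    exact Matrix.det_zero_of_row_eq hne (by ext; simp [hab])
  rw [pfaffianSum, Finset.mul_sum]
  symm
  refine Fintype.sum_of_injective (fun σ : Equiv.Perm κ => (σ : κ → κ)) DFunLike.coe_injective _ _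
    (fun g hg => ?_) (fun σ => ?_)
  · rw [h4 g (fun h => hg ⟨Equiv.ofBijective g h, rfl⟩), mul_zero]
  · rw [Matrix.det_permute]; ring

/-- The standard antisymmetric form on `Fin m × Fin 2`. -/
def pairForm (m : ℕ) : Matrix (Fin m × Fin 2) (Fin m × Fin 2) ℂ := fun a b =>
  if a.1 = b.1 then (if a.2 = 0 ∧ b.2 = 1 then 1 else if a.2 = 1 ∧ b.2 = 0 then -1 else 0) else 0

theorem sign_prodCongr_one {m : ℕ} (π : Equiv.Perm (Fin m)) (s : Fin m → Equiv.Perm (Fin 2)) :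
    Equiv.Perm.sign ((Equiv.prodCongrLeft fun _ : Fin 2 => π) * Equiv.prodCongrRight s) =
      ∏ i, Equiv.Perm.sign (s i) := by
  rw [Equiv.Perm.sign_mul, Equiv.Perm.sign_prodCongrLeft, Equiv.Perm.sign_prodCongrRight]
  simp

/-- A permutation contributes only if it maps pairs to pairs, so it permutes the `m` pairs and flips
some of them: `2^m m!` choices. Permuting pairs is even, and the sign of the flips cancels that of
the matrix entries, so each term is 1. -/
theorem pfaffianSum_pairForm (m : ℕ) :
    pfaffianSum (Equiv.refl _) (pairForm m) = ((2 ^ m * m.factorial : ℕ) : ℂ) := by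
  have h0 : ∑ _x : Equiv.Perm (Fin m) × (Fin m → Equiv.Perm (Fin 2)), (1 : ℂ) =
      ((2 ^ m * m.factorial : ℕ) : ℂ) := by
    simp [Fintype.card_perm, mul_comm]
  rw [← h0, pfaffianSum]
  symm
  have hs : ∀ s : Equiv.Perm (Fin 2),
      (if s 0 = 0 ∧ s 1 = 1 then 1 else if s 0 = 1 ∧ s 1 = 0 then -1 else 0 : ℤ) =
        (Equiv.Perm.sign s : ℤ) := by decide
  refine Fintype.sum_of_injective (fun x : Equiv.Perm (Fin m) × (Fin m → Equiv.Perm (Fin 2)) =>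
    (Equiv.prodCongrLeft fun _ : Fin 2 => x.1) * Equiv.prodCongrRight x.2) ?_ _ _ ?_ ?_
  · rintro ⟨π, s⟩ ⟨π', s'⟩ h
    have h1 (i : Fin m) (c : Fin 2) : (π i, s i c) = (π' i, s' i c) := by
      simpa using congrArg (fun σ : Equiv.Perm (Fin m × Fin 2) => σ (i, c)) h
    simp only [Prod.mk.injEq] at h1 ⊢
    exact ⟨Equiv.ext fun i => (h1 i 0).1, funext fun i => Equiv.ext fun c => (h1 i c).2⟩
  · intro σ hσ
    by_contra hne
    have h1 : ∀ i, pairForm m (σ (i, 0)) (σ (i, 1)) ≠ 0 := by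
      have := right_ne_zero_of_mul hne
      simpa [Finset.prod_ne_zero_iff] using this
    have h2 : ∀ i, (σ (i, 0)).1 = (σ (i, 1)).1 := fun i => by
      by_contra h; exact h1 i (by simp [pairForm, h])
    have h3 : ∀ i, (σ (i, 0)).2 ≠ (σ (i, 1)).2 := fun i h => by
      have := σ.injective (Prod.ext (h2 i) h)
      simp at this
    have hinj : Function.Injective fun i => (σ (i, 0)).1 := by
      intro i j hij
      simp only at hij
      have : (σ (j, 0)).2 = (σ (i, 0)).2 ∨ (σ (j, 0)).2 = (σ (i, 1)).2 := by
        have := h3 i; omega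
      rcases this with h | h
      · have := σ.injective (Prod.ext hij.symm h)
        simpa using this.symm
      · have := σ.injective (Prod.ext (hij.symm.trans (h2 i)) h)
        simp at this
    refine hσ ⟨⟨Equiv.ofBijective _ (Finite.injective_iff_bijective.1 hinj), fun i =>
      Equiv.ofBijective (fun c => (σ (i, c)).2) (Finite.injective_iff_bijective.1 ?_)⟩, ?_⟩
    · intro c d hcd
      have := h3 i
      fin_cases c <;> fin_cases d
      exacts [rfl, (this hcd).elim, (this hcd.symm).elim, rfl]
    · ext1 ⟨i, c⟩
      refine Prod.ext ?_ (by simp)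
      fin_cases c
      · simp
      · simpa using h2 i
  · rintro ⟨π, s⟩
    rw [sign_prodCongr_one]
    simp only [Units.coe_prod, Int.cast_prod]
    rw [← Finset.prod_mul_distrib]
    symm
    refine Finset.prod_eq_one fun i _ => ?_
    have : pairForm m (((Equiv.prodCongrLeft fun _ : Fin 2 => π) * Equiv.prodCongrRight s)
        ((Equiv.refl _) (i, 0))) (((Equiv.prodCongrLeft fun _ : Fin 2 => π) *
        Equiv.prodCongrRight s) ((Equiv.refl _) (i, 1))) = ((Equiv.Perm.sign (s i) : ℤ) : ℂ) := by
      rw [← hs (s i)]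
      simp only [pairForm, Equiv.refl_apply, Equiv.Perm.mul_apply, Equiv.prodCongrRight_apply,
        Equiv.prodCongrLeft_apply, if_true]
      push_cast
      rfl
    rw [this, ← Int.cast_mul, ← Units.val_mul, Int.units_mul_self]
    simp

theorem pfaffian_eq {m : ℕ} (A : Matrix (Fin m ⊕ Fin m) (Fin m ⊕ Fin m) ℂ) :
    pfaffian A = ((2 ^ m * m.factorial : ℕ) : ℂ)⁻¹ * pfaffianSum ((pairEquiv m).trans
      (finSumFinEquiv.trans (finCongr (two_mul m).symm)).symm) A := by
  rw [pfaffian, pfaffianFin_eq, pfaffianSum_reindex]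

theorem pfaffian_transpose_mul_mul {m : ℕ} (W A : Matrix (Fin m ⊕ Fin m) (Fin m ⊕ Fin m) ℂ) :
    pfaffian (Wᵀ * A * W) = W.det * pfaffian A := by
  rw [pfaffian_eq, pfaffian_eq, pfaffianSum_transpose_mul_mul]
  ring

/-- The equivalence which takes `J` to `pairForm`. -/
def sumPairEquiv (m : ℕ) : Fin m ⊕ Fin m ≃ Fin m × Fin 2 where
  toFun := Sum.elim (fun i => (i, 0)) (fun i => (i, 1))
  invFun p := if p.2 = 0 then Sum.inl p.1 else Sum.inr p.1
  left_inv := by rintro (i | i) <;> simp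
  right_inv := by rintro ⟨i, c⟩; fin_cases c <;> simp

theorem J_eq_reindex (m : ℕ) :
    J m = Matrix.reindex (sumPairEquiv m).symm (sumPairEquiv m).symm (pairForm m) := by
  ext (i | i) (j | j) <;> simp [J, pairForm, sumPairEquiv, Matrix.one_apply]
  split_ifs <;> simp

/-- `J` lists its indices by blocks and not by pairs, which costs a sign depending on `m`. The index
contains two Pfaffians, so the square suffices. -/
theorem pfaffian_J_sq (m : ℕ) : pfaffian (J m) ^ 2 = 1 := by
  have h (e : Fin m × Fin 2 ≃ Fin m × Fin 2) : pfaffianSum e (pairForm m) =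
      ((Equiv.Perm.sign e : ℤ) : ℂ) * ((2 ^ m * m.factorial : ℕ) : ℂ) := by
    rw [← pfaffianSum_pairForm, ← pfaffianSum_trans, Equiv.refl_trans]
  have hc : ((2 ^ m * m.factorial : ℕ) : ℂ) ≠ 0 := by
    rw [Nat.cast_ne_zero]; positivity
  rw [pfaffian_eq, J_eq_reindex, pfaffianSum_reindex, h, mul_comm, mul_assoc, mul_inv_cancel₀ hc,
    mul_one, ← Int.cast_pow, ← Units.val_pow_eq_pow_val, Int.units_sq]
  simp

end Pfaffian

/-! ### Moving a column of a family of unitaries by reflections -/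

section Loops

theorem joined_of_continuous_uncurry {X Y : Type*} [TopologicalSpace X] [TopologicalSpace Y]
    {f g : C(X, Y)} (F : unitInterval → X → Y) (hF : Continuous (Function.uncurry F))
    (h0 : ∀ x, F 0 x = f x) (h1 : ∀ x, F 1 x = g x) : Joined f g :=
  ⟨{ toContinuousMap := ContinuousMap.curry ⟨Function.uncurry F, hF⟩
     source' := by ext x; exact h0 x
     target' := by ext x; exact h1 x }⟩

/-- A continuous complex function on the circle is a uniform limit of functions without zeros. -/
theorem exists_nonvanishing_approx (c : C(UnitAddCircle, ℂ)) {ε : ℝ} (hε : 0 < ε) :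
    ∃ c' : C(UnitAddCircle, ℂ), (∀ t, c' t ≠ 0) ∧ ∀ t, ‖c' t - c t‖ < ε := by
  have hc : c ∈ closure ((Submodule.span ℂ (Set.range (fourier (T := 1))) :
      Submodule ℂ C(UnitAddCircle, ℂ)) : Set C(UnitAddCircle, ℂ)) := by
    rw [← Submodule.topologicalClosure_coe, span_fourier_closure_eq_top]; trivial
  obtain ⟨q, hq, hqc⟩ := Metric.mem_closure_iff.1 hc (ε / 2) (half_pos hε)
  have hsm : ContDiff ℝ 1 fun t : ℝ => q (t : UnitAddCircle) := by
    clear hqc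
    induction hq using Submodule.span_induction with
    | mem x hx =>
      obtain ⟨n, rfl⟩ := hx
      simp only [fourier_coe_apply]
      exact ((contDiff_const.mul Complex.ofRealCLM.contDiff).div_const _).cexp
    | zero => simpa using contDiff_const
    | add x y _ _ hx hy => simpa using hx.add hy
    | smul a x _ hx => simpa using contDiff_const.mul hx
  -- A `C¹` curve cannot fill the plane, so the trigonometric polynomial omits arbitrarily small
  -- values `δ`; subtracting one removes all zeros.
  have hd := hsm.dense_compl_range_of_finrank_lt_finrank (by simp)
  obtain ⟨δ, hδ, hδ'⟩ := Metric.mem_closure_iff.1 (hd 0) (ε / 2) (half_pos hε)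
  refine ⟨q - ContinuousMap.const _ δ, fun t h => hδ ?_, fun t => ?_⟩
  · obtain ⟨s, rfl⟩ := QuotientAddGroup.mk_surjective t
    exact ⟨s, by simpa [sub_eq_zero] using h⟩
  · have h1 : ‖q t - c t‖ < ε / 2 := by
      rw [← dist_eq_norm, dist_comm]
      exact (ContinuousMap.dist_apply_le_dist t).trans_lt hqc
    have h2 : ‖δ‖ < ε / 2 := by simpa using hδ'
    calc ‖(q t - δ) - c t‖ = ‖(q t - c t) - δ‖ := by congr 1; ring
      _ ≤ _ := norm_sub_le _ _
      _ < ε := by linarith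

theorem star_dotProduct_self_eq {κ : Type*} [Fintype κ] (w : κ → ℂ) :
    star w ⬝ᵥ w = ((∑ i, ‖w i‖ ^ 2 : ℝ) : ℂ) := by
  simp [dotProduct, Complex.conj_mul']

theorem star_dotProduct_self_ne_zero {κ : Type*} [Fintype κ] {w : κ → ℂ} (hw : w ≠ 0) :
    star w ⬝ᵥ w ≠ 0 := by
  rw [star_dotProduct_self_eq, Complex.ofReal_ne_zero]
  obtain ⟨i, hi⟩ := Function.ne_iff.1 hw
  refine (Finset.sum_pos' (fun j _ => by positivity) ⟨i, Finset.mem_univ i, ?_⟩).ne'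
  have : 0 < ‖w i‖ := norm_pos_iff.2 hi
  positivity

variable {κ : Type*} [Fintype κ] [DecidableEq κ]

/-- The complex reflection which multiplies `w` by `ζ` and fixes the orthogonal complement. -/
def complexReflection (ζ : ℂ) (w : κ → ℂ) : Matrix κ κ ℂ :=
  1 + ((ζ - 1) / (star w ⬝ᵥ w)) • Matrix.vecMulVec w (star w)

theorem complexReflection_mem {ζ : ℂ} (hζ : ‖ζ‖ = 1) {w : κ → ℂ} (hw : w ≠ 0) :
    complexReflection ζ w ∈ Matrix.unitaryGroup κ ℂ := by
  have hD : star w ⬝ᵥ w ≠ 0 := star_dotProduct_self_ne_zero hw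
  have hDs : (starRingEnd ℂ) (star w ⬝ᵥ w) = star w ⬝ᵥ w := by
    rw [star_dotProduct_self_eq, Complex.conj_ofReal]
  have hz : ζ * (starRingEnd ℂ) ζ = 1 := by rw [Complex.mul_conj']; simp [hζ]
  rw [Matrix.mem_unitaryGroup_iff, Matrix.star_eq_conjTranspose, complexReflection,
    Matrix.conjTranspose_add, Matrix.conjTranspose_smul, Matrix.conjTranspose_vecMulVec,
    Matrix.conjTranspose_one, star_star]
  set M := Matrix.vecMulVec w (star w) with hM
  have hMM : M * M = (star w ⬝ᵥ w) • M := by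
    rw [hM, Matrix.vecMulVec_mul_vecMulVec, Matrix.vecMulVec_smul]
  simp only [Matrix.add_mul, Matrix.mul_add, Matrix.one_mul, Matrix.mul_one, Matrix.smul_mul,
    Matrix.mul_smul, hMM, smul_smul]
  rw [smul_add, smul_smul, ← add_smul, add_assoc, ← add_smul]
  convert add_zero (1 : Matrix κ κ ℂ)
  rw [smul_eq_zero]; left
  simp only [RCLike.star_def, map_div₀, map_sub, map_one, hDs]
  field_simp
  linear_combination hz

/-- Since `⟨x, u⟩` is real and both vectors are unit, `x - u` is orthogonal to `x + u`. The
reflection negates `x + u` and fixes `x - u`, hence sends their half-sum `x` to `-u`. -/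
theorem complexReflection_mulVec {x u : κ → ℂ} (hx : star x ⬝ᵥ x = 1) (hu : star u ⬝ᵥ u = 1)
    {r : ℝ} (hr : 0 < r) (hxu : star x ⬝ᵥ u = r) :
    complexReflection (-1) (x + u) *ᵥ x = -u := by
  have hux : star u ⬝ᵥ x = r := by
    rw [Matrix.star_dotProduct, hxu]
    simp
  have hr1 : (1 + r : ℂ) ≠ 0 := by
    rw [← Complex.ofReal_one, ← Complex.ofReal_add, Complex.ofReal_ne_zero]; positivity
  have h1 : star (x + u) ⬝ᵥ (x + u) = 2 * (1 + r) := by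
    simp [add_dotProduct, dotProduct_add, hx, hu, hxu, hux]; ring
  have h2 : star (x + u) ⬝ᵥ x = 1 + r := by
    simp [add_dotProduct, hx, hux]
  rw [complexReflection, Matrix.add_mulVec, Matrix.one_mulVec, Matrix.smul_mulVec,
    Matrix.vecMulVec_mulVec, h1, h2]
  ext i
  simp
  field_simp
  ring

theorem column_dotProduct (g : Matrix.unitaryGroup κ ℂ) (i : κ) :
    star (fun j => (g : Matrix κ κ ℂ) j i) ⬝ᵥ (fun j => (g : Matrix κ κ ℂ) j i) = 1 := by
  have := congrFun (congrFun (Matrix.mem_unitaryGroup_iff'.1 g.2) i) i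
  simpa [Matrix.mul_apply, Matrix.star_apply, dotProduct] using this

variable {X : Type*} [TopologicalSpace X]

theorem continuous_coe_apply (g : C(X, Matrix.unitaryGroup κ ℂ)) (i j : κ) :
    Continuous fun t => (g t : Matrix κ κ ℂ) i j :=
  (continuous_subtype_val.comp g.continuous).matrix_elem i j

/-- Letting the eigenvalue run from 1 to -1 along a half circle deforms the identity into the
reflection that moves the column. Positivity of the pairing keeps the axis `x + u` away from 0 for
every `t`. -/
theorem exists_joined_column_eq_neg [LocallyCompactSpace X] (g : C(X, Matrix.unitaryGroup κ ℂ)) (i₀ : κ)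
    (u : X → κ → ℂ) (hu : Continuous u) (hu1 : ∀ t, star (u t) ⬝ᵥ u t = 1)
    (r : X → ℝ) (hr : ∀ t, 0 < r t)
    (hgu : ∀ t, star (fun j => (g t : Matrix κ κ ℂ) j i₀) ⬝ᵥ u t = r t) :
    ∃ g' : C(X, Matrix.unitaryGroup κ ℂ), Joined g g' ∧
      ∀ t j, (g' t : Matrix κ κ ℂ) j i₀ = -u t j := by
  set w : X → κ → ℂ := fun t => (fun j => (g t : Matrix κ κ ℂ) j i₀) + u t with hw
  have hw0 (t) : w t ≠ 0 := fun h => by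
    have h1 := congrArg (fun v => star (fun j => (g t : Matrix κ κ ℂ) j i₀) ⬝ᵥ v) h
    simp only [hw, dotProduct_add, column_dotProduct, hgu, dotProduct_zero] at h1
    have := congrArg Complex.re h1
    simp at this
    linarith [hr t]
  have hwc : Continuous w := (continuous_pi fun j => continuous_coe_apply g j i₀).add hu
  have hζ (s : unitInterval) : ‖Complex.exp (Real.pi * s * Complex.I)‖ = 1 := by
    rw [← Complex.ofReal_mul, Complex.norm_exp_ofReal_mul_I]
  let F : unitInterval → X → Matrix.unitaryGroup κ ℂ := fun s t =>
    ⟨complexReflection (Complex.exp (Real.pi * s * Complex.I)) (w t),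
      complexReflection_mem (hζ s) (hw0 t)⟩
  have hF : Continuous (Function.uncurry F) := by
    refine Continuous.subtype_mk ?_ _
    have hne : ∀ p : unitInterval × X, star (w p.2) ⬝ᵥ w p.2 ≠ 0 := fun p =>
      star_dotProduct_self_ne_zero (hw0 p.2)
    simp only [complexReflection]
    refine continuous_const.add (Continuous.smul (Continuous.div (by fun_prop)
      (by fun_prop) hne) (by fun_prop))
  let H : C(X, Matrix.unitaryGroup κ ℂ) := ⟨F 1, by fun_prop⟩
  have hH : Joined 1 H := joined_of_continuous_uncurry F hF (fun t => by
    ext1; simp [F, complexReflection]) (fun t => rfl)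
  refine ⟨H * g, by simpa using hH.mul (Joined.refl g), fun t j => ?_⟩
  have := congrFun (complexReflection_mulVec (column_dotProduct (g t) i₀) (hu1 t) (hr t) (hgu t)) j
  simpa [H, F, Matrix.mul_apply, Matrix.mulVec, dotProduct, hw] using this

end Loops

/-! ### Clearing a column, diagonal loops and determinants -/

section LoopClassification

variable {κ : Type*} [Fintype κ] [DecidableEq κ]

/-- Up to homotopy, a chosen column of a loop of unitary matrices vanishes off the diagonal. -/
theorem exists_joined_column_eq_zero (g : C(UnitAddCircle, Matrix.unitaryGroup κ ℂ)) (i₀ : κ) :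
    ∃ g' : C(UnitAddCircle, Matrix.unitaryGroup κ ℂ), Joined g g' ∧
      ∀ t j, j ≠ i₀ → (g' t : Matrix κ κ ℂ) j i₀ = 0 := by
  obtain ⟨c, hc0, hc⟩ := exists_nonvanishing_approx
    ⟨fun t => (g t : Matrix κ κ ℂ) i₀ i₀, continuous_coe_apply g i₀ i₀⟩ (ε := 1) one_pos
  simp only [ContinuousMap.coe_mk] at hc
  set x : UnitAddCircle → κ → ℂ := fun t j => (g t : Matrix κ κ ℂ) j i₀ with hx
  have hxc : Continuous x := continuous_pi fun j => continuous_coe_apply g j i₀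
  -- The column with its entry at `i₀` replaced by the zero-free approximation `c`. As the error is
  -- below 1 and `|x i₀| ≤ 1`, the pairing `s = ⟨x, y⟩` has no zeros either.
  set y : UnitAddCircle → κ → ℂ := fun t => x t + Pi.single i₀ (c t - x t i₀) with hy
  have hyc : Continuous y :=
    hxc.add ((continuous_single i₀).comp (c.continuous.sub (continuous_coe_apply g i₀ i₀)))
  have hy0 (t) : y t i₀ = c t := by simp [hy]
  have hyn (t) : y t ≠ 0 := fun h => hc0 t (by rw [← hy0, h]; rfl)
  set s : UnitAddCircle → ℂ := fun t => star (x t) ⬝ᵥ y t with hs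
  have hsc : Continuous s := by fun_prop
  have hs0 (t) : s t ≠ 0 := by
    have h1 : s t = 1 + star (x t i₀) * (c t - x t i₀) := by
      simp only [hs, hy, dotProduct_add, dotProduct_single, Pi.star_apply]
      rw [column_dotProduct]
    have h2 : ‖star (x t i₀) * (c t - x t i₀)‖ < 1 := by
      rw [norm_mul, norm_star]
      have h3 : ‖x t i₀‖ ≤ 1 := entry_norm_bound_of_unitary (g t).2 i₀ i₀
      nlinarith [hc t, norm_nonneg (c t - x t i₀), norm_nonneg (x t i₀)]
    intro h
    have h3 : star (x t i₀) * (c t - x t i₀) = -1 := by linear_combination -h1 + h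
    rw [h3] at h2
    simp at h2
  set N : UnitAddCircle → ℝ := fun t => Real.sqrt (∑ i, ‖y t i‖ ^ 2) with hN
  have hNc : Continuous N := by fun_prop
  have hN2 (t) : star (y t) ⬝ᵥ y t = ((N t : ℝ) : ℂ) ^ 2 := by
    rw [star_dotProduct_self_eq, ← Complex.ofReal_pow, Real.sq_sqrt (by positivity)]
  have hN0 (t) : N t ≠ 0 := fun h => star_dotProduct_self_ne_zero (hyn t) (by rw [hN2, h]; simp)
  have hNp (t) : 0 < N t := lt_of_le_of_ne (Real.sqrt_nonneg _) (hN0 t).symm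
  have hNC (t) : ((N t : ℝ) : ℂ) ≠ 0 := Complex.ofReal_ne_zero.2 (hN0 t)
  have hsC (t) : ((‖s t‖ : ℝ) : ℂ) ≠ 0 := Complex.ofReal_ne_zero.2 (norm_ne_zero_iff.2 (hs0 t))
  -- This factor normalizes `y` and rotates it so that its pairing with `x` becomes positive, as the
  -- reflection requires.
  set a : UnitAddCircle → ℂ := fun t => star (s t) / (‖s t‖ * N t) with ha
  have hac : Continuous a := by
    refine Continuous.div (by fun_prop) (by fun_prop) fun t => mul_ne_zero (hsC t) (hNC t)
  have ha0 (t) : a t ≠ 0 := div_ne_zero (by simpa using hs0 t) (mul_ne_zero (hsC t) (hNC t))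
  have has (t) : star (s t) * s t = (‖s t‖ : ℂ) ^ 2 := Complex.conj_mul' _
  set u : UnitAddCircle → κ → ℂ := fun t => a t • y t with hu
  have huc : Continuous u := by fun_prop
  have hu1 (t) : star (u t) ⬝ᵥ u t = 1 := by
    simp only [hu, star_smul, smul_dotProduct, dotProduct_smul, smul_eq_mul, hN2, ha]
    have h1 := has t
    have h2 := hNC t
    have h3 := hsC t
    simp only [RCLike.star_def, map_div₀, map_mul, Complex.conj_ofReal, Complex.conj_conj] at h1 ⊢
    field_simp
    linear_combination h1
  have hxu (t) : star (x t) ⬝ᵥ u t = ((‖s t‖ / N t : ℝ) : ℂ) := by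
    simp only [hu, dotProduct_smul, smul_eq_mul, ha]
    have h1 := has t
    have h2 := hNC t
    have h3 := hsC t
    change star (s t) / (‖s t‖ * N t) * s t = _
    push_cast
    field_simp
    linear_combination h1
  obtain ⟨g₁, hg₁, hg₁'⟩ := exists_joined_column_eq_neg g i₀ u huc hu1 (fun t => ‖s t‖ / N t)
    (fun t => div_pos (norm_pos_iff.2 (hs0 t)) (hNp t)) hxu
  have hu0 (t) : u t i₀ ≠ 0 := by
    simp only [hu, Pi.smul_apply, smul_eq_mul, hy0]
    exact mul_ne_zero (ha0 t) (hc0 t)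
  have huC (t) : ((‖u t i₀‖ : ℝ) : ℂ) ≠ 0 := Complex.ofReal_ne_zero.2 (norm_ne_zero_iff.2 (hu0 t))
  -- The column is now `-u` and its entry at `i₀` has no zeros. A second reflection takes it to a
  -- multiple of the basis vector, with the phase chosen to make the pairing positive.
  set p : UnitAddCircle → κ → ℂ := fun t => Pi.single i₀ (-(u t i₀ / ‖u t i₀‖)) with hp
  have hpc : Continuous p := by
    refine (continuous_single i₀).comp (Continuous.neg (Continuous.div (by fun_prop)
      (by fun_prop) huC))
  have hp1 (t) : star (p t) ⬝ᵥ p t = 1 := by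
    have h1 : (starRingEnd ℂ) (u t i₀) * u t i₀ = (‖u t i₀‖ : ℂ) ^ 2 := Complex.conj_mul' _
    have h3 := huC t
    simp only [hp, dotProduct_single, Pi.star_apply, Pi.single_eq_same, RCLike.star_def, map_neg,
      map_div₀, Complex.conj_ofReal]
    field_simp
    linear_combination h1
  obtain ⟨g₂, hg₂, hg₂'⟩ := exists_joined_column_eq_neg g₁ i₀ p hpc hp1 (fun t => ‖u t i₀‖)
    (fun t => norm_pos_iff.2 (hu0 t)) (fun t => by
      have h1 : (starRingEnd ℂ) (u t i₀) * u t i₀ = (‖u t i₀‖ : ℂ) ^ 2 := Complex.conj_mul' _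
      have h3 := huC t
      simp only [hp, dotProduct_single, Pi.star_apply, hg₁', RCLike.star_def, map_neg]
      field_simp
      linear_combination h1)
  exact ⟨g₂, hg₁.trans hg₂, fun t j hj => by simp [hg₂', hp, hj]⟩

/-- The diagonal matrix with a single entry different from `1`. -/
def diagU (i : κ) : Circle →* Matrix.unitaryGroup κ ℂ where
  toFun z := ⟨Matrix.diagonal (Pi.mulSingle i (z : ℂ)), by
    rw [Matrix.mem_unitaryGroup_iff, Matrix.star_eq_conjTranspose, Matrix.diagonal_conjTranspose,
      Matrix.diagonal_mul_diagonal, ← Matrix.diagonal_one]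
    congr 1
    ext j
    rcases eq_or_ne j i with rfl | h
    · rw [Pi.mulSingle_eq_same, Pi.star_apply, Pi.mulSingle_eq_same, RCLike.star_def, Complex.mul_conj',
        show ‖(z : ℂ)‖ = 1 from Circle.norm_coe z]
      simp
    · simp [h]⟩
  map_one' := by ext1; simp
  map_mul' z w := Subtype.ext <| by
    change Matrix.diagonal (Pi.mulSingle i ((z * w : Circle) : ℂ)) =
      Matrix.diagonal (Pi.mulSingle i (z : ℂ)) * Matrix.diagonal (Pi.mulSingle i (w : ℂ))
    rw [Matrix.diagonal_mul_diagonal, Circle.coe_mul, Pi.mulSingle_mul]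
    rfl

theorem diagU_val (i : κ) (z : Circle) :
    (diagU i z : Matrix κ κ ℂ) = Matrix.diagonal (Pi.mulSingle i (z : ℂ)) := rfl

theorem continuous_diagU (i : κ) : Continuous (diagU i : Circle → Matrix.unitaryGroup κ ℂ) :=
  Continuous.subtype_mk (((continuous_mulSingle i).comp continuous_subtype_val).matrix_diagonal) _

/-- The determinant of a unitary matrix. -/
def detU : Matrix.unitaryGroup κ ℂ →* Circle where
  toFun u := ⟨(u : Matrix κ κ ℂ).det, by
    have h := congrArg Matrix.det (Matrix.mem_unitaryGroup_iff.1 u.2)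
    rw [Matrix.det_mul, Matrix.star_eq_conjTranspose, Matrix.det_conjTranspose, Matrix.det_one,
      RCLike.star_def, Complex.mul_conj'] at h
    rw [Submonoid.unitSphere, Submonoid.mem_mk, Subsemigroup.mem_mk, mem_sphere_zero_iff_norm,
      ← pow_eq_one_iff_of_nonneg (norm_nonneg _) two_ne_zero]
    exact_mod_cast h⟩
  map_one' := by ext1; simp
  map_mul' u v := by ext1; exact Matrix.det_mul _ _

theorem detU_coe (u : Matrix.unitaryGroup κ ℂ) : (detU u : ℂ) = (u : Matrix κ κ ℂ).det := rfl

theorem continuous_detU : Continuous (detU : Matrix.unitaryGroup κ ℂ → Circle) :=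
  Continuous.subtype_mk (continuous_subtype_val.matrix_det) _

theorem detU_diagU (i : κ) (z : Circle) : detU (diagU i z) = z := by
  ext1
  rw [detU_coe, diagU_val, Matrix.det_diagonal, Fintype.prod_eq_single i fun j hj => Pi.mulSingle_eq_of_ne hj _,
    Pi.mulSingle_eq_same]

variable {X : Type*} [TopologicalSpace X]

/-- The loop of diagonal matrices given by a loop in the circle. -/
def diagLoop (i : κ) (z : C(X, Circle)) : C(X, Matrix.unitaryGroup κ ℂ) :=
  ⟨fun t => diagU i (z t), (continuous_diagU i).comp z.continuous⟩

/-- The loop of determinants. -/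
def detLoop (g : C(X, Matrix.unitaryGroup κ ℂ)) : C(X, Circle) :=
  ⟨fun t => detU (g t), continuous_detU.comp g.continuous⟩

/-- The two loops are conjugate by a permutation matrix, which is joined to 1. -/
theorem joined_diagLoop [LocallyCompactSpace X] (i j : κ) (z : C(X, Circle)) :
    Joined (diagLoop i z) (diagLoop j z) := by
  set σ : Matrix.unitaryGroup κ ℂ := ⟨(Equiv.swap i j).permMatrix ℂ, by
    rw [Matrix.mem_unitaryGroup_iff, Matrix.star_eq_conjTranspose, Matrix.conjTranspose_permMatrix,
      ← Matrix.permMatrix_mul]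
    simp⟩ with hσ
  have hc (u v : Matrix.unitaryGroup κ ℂ) :
      Joined (ContinuousMap.const X u) (ContinuousMap.const X v) :=
    (joined_unitaryGroup u v).map ContinuousMap.continuous_const'
  have h := ((hc 1 σ).mul (Joined.refl (diagLoop i z))).mul (hc 1 σ⁻¹)
  convert h using 1
  · ext1 t; simp
  · ext1 t
    have : (diagU j (z t) : Matrix κ κ ℂ) * (σ : Matrix κ κ ℂ) =
        (σ : Matrix κ κ ℂ) * (diagU i (z t) : Matrix κ κ ℂ) := by
      simp only [hσ, diagU_val]
      ext a b
      rw [Matrix.diagonal_mul, Matrix.mul_diagonal, Equiv.Perm.permMatrix, PEquiv.toMatrix_apply]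
      simp only [Equiv.toPEquiv_apply, Option.mem_some_iff]
      split_ifs with h
      · rw [mul_one, one_mul, ← h]
        rcases eq_or_ne a j with rfl | haj
        · rw [Equiv.swap_apply_right, Pi.mulSingle_eq_same, Pi.mulSingle_eq_same]
        · rw [Pi.mulSingle_eq_of_ne haj, Pi.mulSingle_eq_of_ne]
          rwa [Ne, Equiv.swap_apply_eq_iff, Equiv.swap_apply_left]
      · simp
    have h2 : diagU j (z t) * σ = σ * diagU i (z t) := Subtype.ext this
    have h3 : diagU j (z t) = σ * diagU i (z t) * σ⁻¹ := by rw [← h2, mul_inv_cancel_right]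
    simp [diagLoop, h3]

end LoopClassification

/-! ### Induction on the size, and winding numbers -/

section LoopClassification

variable {κ : Type*} [Fintype κ] [DecidableEq κ]

/-- Splitting off one index. -/
def splitEquiv (i₀ : κ) : κ ≃ Unit ⊕ {j : κ // j ≠ i₀} where
  toFun j := if h : j = i₀ then Sum.inl () else Sum.inr ⟨j, h⟩
  invFun := Sum.elim (fun _ => i₀) Subtype.val
  left_inv j := by by_cases h : j = i₀ <;> simp [h]
  right_inv := by rintro (_ | ⟨j, h⟩) <;> simp_all

/-- The block diagonal unitary matrix with a block of size one at the index `i₀`. -/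
def blockU (i₀ : κ) (z : Circle) (u : Matrix.unitaryGroup {j : κ // j ≠ i₀} ℂ) :
    Matrix.unitaryGroup κ ℂ :=
  ⟨(Matrix.fromBlocks (Matrix.diagonal fun _ : Unit => (z : ℂ)) 0 0
    (u : Matrix {j : κ // j ≠ i₀} {j : κ // j ≠ i₀} ℂ)).submatrix (splitEquiv i₀)
      (splitEquiv i₀), by
    rw [Matrix.mem_unitaryGroup_iff, Matrix.star_eq_conjTranspose, Matrix.conjTranspose_submatrix,
      Matrix.submatrix_mul_equiv, Matrix.fromBlocks_conjTranspose, Matrix.fromBlocks_multiply,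
      ← Matrix.star_eq_conjTranspose (u : Matrix {j : κ // j ≠ i₀} {j : κ // j ≠ i₀} ℂ),
      Matrix.mem_unitaryGroup_iff.1 u.2, Matrix.diagonal_conjTranspose,
      Matrix.diagonal_mul_diagonal]
    have : (fun i : Unit => (z : ℂ) * star (fun _ : Unit => (z : ℂ)) i) = fun _ => 1 := by
      ext i
      rw [Pi.star_apply, RCLike.star_def, Complex.mul_conj',
        show ‖(z : ℂ)‖ = 1 from Circle.norm_coe z]
      simp
    rw [this]
    simp⟩

theorem continuous_blockU (i₀ : κ) :
    Continuous fun p : Circle × Matrix.unitaryGroup {j : κ // j ≠ i₀} ℂ =>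
      blockU i₀ p.1 p.2 := by
  refine Continuous.subtype_mk (Continuous.matrix_submatrix (Continuous.matrix_fromBlocks
    (Continuous.matrix_diagonal ?_) continuous_const continuous_const
    (continuous_subtype_val.comp continuous_snd)) _ _) _
  exact continuous_pi fun _ => continuous_subtype_val.comp continuous_fst

theorem blockU_diagU (i₀ : κ) (i : {j : κ // j ≠ i₀}) (z w : Circle) :
    blockU i₀ z (diagU i w) = diagU i₀ z * diagU i.1 w := by
  refine Subtype.ext ?_
  rw [Submonoid.coe_mul, diagU_val, diagU_val, Matrix.diagonal_mul_diagonal]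
  change (Matrix.fromBlocks (Matrix.diagonal _) 0 0 (Matrix.diagonal _)).submatrix _ _ = _
  rw [Matrix.fromBlocks_diagonal, Matrix.submatrix_diagonal_equiv]
  congr 1
  funext j
  by_cases hj : j = i₀
  · subst hj
    simp [splitEquiv, Pi.mulSingle_eq_of_ne i.2.symm]
  · rcases eq_or_ne j i.1 with rfl | hji
    · simp [splitEquiv, hj]
    · simp [splitEquiv, hj, hji, Subtype.ext_iff]

theorem blockU_of_isEmpty (i₀ : κ) [IsEmpty {j : κ // j ≠ i₀}] (z : Circle)
    (u : Matrix.unitaryGroup {j : κ // j ≠ i₀} ℂ) : blockU i₀ z u = diagU i₀ z := by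
  ext a b
  have ha (a : κ) : a = i₀ := by
    by_contra h; exact isEmptyElim (⟨a, h⟩ : {j : κ // j ≠ i₀})
  rw [ha a, ha b]
  simp [blockU, splitEquiv, diagU_val]

/-- A unitary matrix with a diagonal column is block diagonal. -/
theorem exists_eq_blockU {X : Type*} [TopologicalSpace X] (i₀ : κ)
    (g : C(X, Matrix.unitaryGroup κ ℂ))
    (h : ∀ t j, j ≠ i₀ → (g t : Matrix κ κ ℂ) j i₀ = 0) :
    ∃ (z : C(X, Circle)) (g' : C(X, Matrix.unitaryGroup {j : κ // j ≠ i₀} ℂ)),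
      ∀ t, g t = blockU i₀ (z t) (g' t) := by
  have h1 (t) : ‖(g t : Matrix κ κ ℂ) i₀ i₀‖ = 1 := by
    have h2 := column_dotProduct (g t) i₀
    rw [star_dotProduct_self_eq, Finset.sum_eq_single i₀ (fun j _ hj => by simp [h t j hj])
      (by simp)] at h2
    exact (pow_eq_one_iff_of_nonneg (norm_nonneg _) two_ne_zero).1 (by exact_mod_cast h2)
  have hrow (t j) (hj : j ≠ i₀) : (g t : Matrix κ κ ℂ) i₀ j = 0 := by
    have h2 := congrFun (congrFun (Matrix.mem_unitaryGroup_iff.1 (g t).2) i₀) i₀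
    -- The row at `i₀` is a unit vector whose entry at `i₀` already has modulus 1, so its other
    -- entries vanish.
    have h3 : ∑ k, ‖(g t : Matrix κ κ ℂ) i₀ k‖ ^ 2 = 1 := by
      simp only [Matrix.mul_apply, Matrix.star_apply, Matrix.one_apply_eq, RCLike.star_def,
        Complex.mul_conj'] at h2
      exact_mod_cast h2
    rw [← Finset.add_sum_erase _ _ (Finset.mem_univ i₀), h1] at h3
    have h4 : ∑ k ∈ Finset.univ.erase i₀, ‖(g t : Matrix κ κ ℂ) i₀ k‖ ^ 2 = 0 := by linarith
    have h5 := (Finset.sum_eq_zero_iff_of_nonneg fun k _ => by positivity).1 h4 j (by simpa using hj)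
    simpa using h5
  have hblock (t) : (g t : Matrix κ κ ℂ).submatrix (splitEquiv i₀).symm (splitEquiv i₀).symm =
      Matrix.fromBlocks (Matrix.diagonal fun _ : Unit => (g t : Matrix κ κ ℂ) i₀ i₀) 0 0
        ((g t : Matrix κ κ ℂ).submatrix Subtype.val Subtype.val) := by
    ext (a | a) (b | b)
    · simp [splitEquiv]
    · simpa [splitEquiv] using hrow t b b.2
    · simpa [splitEquiv] using h t a a.2
    · simp [splitEquiv]
  have hmem (t) : (g t : Matrix κ κ ℂ).submatrix Subtype.val Subtype.val ∈
      Matrix.unitaryGroup {j : κ // j ≠ i₀} ℂ := by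
    have h2 : (g t : Matrix κ κ ℂ).submatrix (splitEquiv i₀).symm (splitEquiv i₀).symm *
        star ((g t : Matrix κ κ ℂ).submatrix (splitEquiv i₀).symm (splitEquiv i₀).symm) = 1 := by
      rw [Matrix.star_eq_conjTranspose, Matrix.conjTranspose_submatrix,
        Matrix.submatrix_mul_equiv, ← Matrix.star_eq_conjTranspose,
        Matrix.mem_unitaryGroup_iff.1 (g t).2, Matrix.submatrix_one_equiv]
    rw [hblock, Matrix.star_eq_conjTranspose, Matrix.fromBlocks_conjTranspose,
      Matrix.fromBlocks_multiply, ← Matrix.fromBlocks_one, Matrix.fromBlocks_inj] at h2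
    rw [Matrix.mem_unitaryGroup_iff, Matrix.star_eq_conjTranspose]
    simpa using h2.2.2.2
  refine ⟨⟨fun t => ⟨(g t : Matrix κ κ ℂ) i₀ i₀, mem_sphere_zero_iff_norm.2 (h1 t)⟩,
    Continuous.subtype_mk (continuous_coe_apply g i₀ i₀) _⟩,
    ⟨fun t => ⟨_, hmem t⟩, Continuous.subtype_mk
      ((continuous_subtype_val.comp g.continuous).matrix_submatrix _ _) _⟩, fun t => ?_⟩
  refine Subtype.ext ?_
  change _ = (Matrix.fromBlocks _ 0 0 ((g t : Matrix κ κ ℂ).submatrix Subtype.val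
    Subtype.val)).submatrix _ _
  have h2 : (g t : Matrix κ κ ℂ) = ((g t : Matrix κ κ ℂ).submatrix (splitEquiv i₀).symm
      (splitEquiv i₀).symm).submatrix (splitEquiv i₀) (splitEquiv i₀) := by simp
  exact h2.trans (congrArg (fun M => M.submatrix (splitEquiv i₀) (splitEquiv i₀)) (hblock t))

/-- Every loop of unitary matrices is homotopic to a loop of diagonal matrices with at most one
entry different from `1`. -/
theorem exists_joined_diagLoop {κ : Type} [Fintype κ] [DecidableEq κ] (i₀ : κ)
    (g : C(UnitAddCircle, Matrix.unitaryGroup κ ℂ)) :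
    ∃ z : C(UnitAddCircle, Circle), Joined g (diagLoop i₀ z) := by
  obtain ⟨n, hn⟩ : ∃ n, Fintype.card κ = n := ⟨_, rfl⟩
  induction n generalizing κ with
  | zero => exact ((Fintype.card_eq_zero_iff.1 hn).false i₀).elim
  | succ n ih =>
    obtain ⟨g₁, hg₁, h0⟩ := exists_joined_column_eq_zero g i₀
    obtain ⟨z, g', hg'⟩ := exists_eq_blockU i₀ g₁ h0
    rcases isEmpty_or_nonempty {j : κ // j ≠ i₀} with hE | ⟨⟨i₁⟩⟩
    · refine ⟨z, ?_⟩
      convert hg₁ using 1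
      ext1 t
      rw [hg', blockU_of_isEmpty]; rfl
    · have hcard : Fintype.card {j : κ // j ≠ i₀} = n := by
        rw [Fintype.card_subtype_compl, hn]; simp
      obtain ⟨w, hw⟩ := ih i₁ g' hcard
      have h1 : Joined g₁ (diagLoop i₀ z * diagLoop i₁.1 w) := by
        obtain ⟨γ⟩ := hw
        have hγ : Continuous fun p : unitInterval × UnitAddCircle => γ p.1 p.2 :=
          ContinuousMap.continuous_uncurry_of_continuous γ.toContinuousMap
        refine joined_of_continuous_uncurry (fun s t => blockU i₀ (z t) (γ s t)) ?_ ?_ ?_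
        · exact (continuous_blockU i₀).comp ((z.continuous.comp continuous_snd).prodMk hγ)
        · intro t; simp [hg']
        · intro t
          simp only [Path.target]
          exact blockU_diagU i₀ i₁ _ _
      refine ⟨z * w, hg₁.trans (h1.trans ?_)⟩
      convert (Joined.refl (diagLoop i₀ z)).mul (joined_diagLoop i₁.1 i₀ w) using 1
      ext1 t; simp [diagLoop]

/-- A logarithm of the determinant is the only obstruction: a loop is homotopic to the diagonal loop
of its determinant, which contracts by scaling `θ`. -/
theorem joined_one_of_detLoop_eq_exp {κ : Type} [Fintype κ] [DecidableEq κ]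
    (g : C(UnitAddCircle, Matrix.unitaryGroup κ ℂ)) (θ : C(UnitAddCircle, ℝ))
    (hθ : ∀ t, detU (g t) = Circle.exp (θ t)) : Joined g 1 := by
  rcases isEmpty_or_nonempty κ with hκ | ⟨⟨i₀⟩⟩
  · convert Joined.refl g
    ext t i; exact isEmptyElim i
  obtain ⟨z, ⟨γ⟩⟩ := exists_joined_diagLoop i₀ g
  have hγ : Continuous fun p : unitInterval × UnitAddCircle => γ p.1 p.2 :=
    ContinuousMap.continuous_uncurry_of_continuous γ.toContinuousMap
  have hγd := continuous_detU.comp hγ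
  have hgd := continuous_detU.comp g.continuous
  have h1 : Joined g (diagLoop i₀ (detLoop g)) := by
    -- The diagonal factor corrects the deformation so that the determinant stays that of `g`
    -- throughout.
    refine joined_of_continuous_uncurry
      (fun s t => γ s t * diagU i₀ ((detU (γ s t))⁻¹ * detU (g t))) ?_ ?_ ?_
    · exact hγ.mul ((continuous_diagU i₀).comp (hγd.inv.mul (hgd.comp continuous_snd)))
    · intro t; simp
    · intro t
      change γ 1 t * diagU i₀ ((detU (γ 1 t))⁻¹ * detU (g t)) = diagU i₀ (detU (g t))
      rw [γ.target, map_mul, map_inv]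
      simp [diagLoop, detU_diagU]
  refine h1.trans (joined_of_continuous_uncurry
    (fun s t => diagU i₀ (Circle.exp ((1 - s) * θ t))) ?_ ?_ ?_)
  · exact (continuous_diagU i₀).comp (by fun_prop)
  · intro t; simp [diagLoop, detLoop, hθ]
  · intro t; simp

/-- Continuous lifts of paths in the circle. -/
theorem exists_path_lift (γ : C(unitInterval, Circle)) :
    ∃ α : C(unitInterval, ℝ), ∀ t, Circle.exp (α t) = γ t := by
  obtain ⟨Γ, h, -⟩ := Circle.isCoveringMap_exp.exists_path_lifts γ (Complex.arg (γ 0))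
    (Circle.exp_arg _).symm
  exact ⟨Γ, fun t => congrFun h t⟩

/-- A loop in the circle is a power of the identity times a loop with a logarithm. -/
theorem exists_winding (z : C(UnitAddCircle, Circle)) :
    ∃ (w : ℤ) (θ : C(UnitAddCircle, ℝ)),
      ∀ t, z t = AddCircle.toCircle t ^ w * Circle.exp (θ t) := by
  obtain ⟨α, hα⟩ := exists_path_lift (z.comp ⟨fun t : unitInterval => ((t : ℝ) : UnitAddCircle),
    (AddCircle.continuous_mk' 1).comp continuous_subtype_val⟩)
  replace hα : ∀ t : unitInterval, Circle.exp (α t) = z ((t : ℝ) : UnitAddCircle) := hα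
  obtain ⟨w, hw⟩ := Circle.exp_eq_exp.1 ((hα 1).trans
    ((congrArg z (by simp)).trans (hα 0).symm))
  -- The lifted phase grows by `2πw` along the loop; removing the linear part makes the rest
  -- periodic.
  let f : ℝ → ℝ := fun x => α (Set.projIcc 0 1 zero_le_one x) - w * (2 * Real.pi) * x
  have hf : Continuous f := by fun_prop
  have hf01 : f 0 = f 1 := by simp [f, hw]
  refine ⟨w, ⟨AddCircle.liftIco 1 0 f, AddCircle.liftIco_zero_continuous hf01 hf.continuousOn⟩,
    fun t => ?_⟩
  obtain ⟨x, hx, rfl⟩ : ∃ x ∈ Set.Ico (0 : ℝ) 1, (x : UnitAddCircle) = t := by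
    have := AddCircle.coe_image_Ico_eq (1 : ℝ) 0
    have h2 : t ∈ ((↑) : ℝ → UnitAddCircle) '' Set.Ico 0 (0 + 1) := by rw [this]; trivial
    simpa using h2
  simp only [ContinuousMap.coe_mk]
  rw [AddCircle.liftIco_zero_coe_apply hx, AddCircle.toCircle_apply_mk, ← Circle.exp_intCast_mul,
    ← Circle.exp_add]
  have hx' : x ∈ Set.Icc (0 : ℝ) 1 := ⟨hx.1, hx.2.le⟩
  rw [← hα ⟨x, hx'⟩]
  congr 1
  simp only [f, Set.projIcc_of_mem zero_le_one hx']
  ring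

end LoopClassification

/-! ### The index of a symmetric loop and its homotopy invariance -/

section SymmetricLoops

variable {m : ℕ}

/-- Loops of unitary matrices with `A(-k) = -A(k)ᵀ`. -/
def symLoop (m : ℕ) : Set C(UnitAddCircle, U m) :=
  {A | ∀ k, (A (-k) : Matrix (Fin m ⊕ Fin m) (Fin m ⊕ Fin m) ℂ) =
    -(A k : Matrix (Fin m ⊕ Fin m) (Fin m ⊕ Fin m) ℂ)ᵀ}

/-- A continuous phase of the determinant on half of the circle. -/
def IsLoopPhase (A : C(UnitAddCircle, U m)) (α : ℝ → ℝ) : Prop :=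
  ContinuousOn α (Set.Icc 0 (1 / 2)) ∧
    ∀ k ∈ Set.Icc (0 : ℝ) (1 / 2), detU (A (k : UnitAddCircle)) = Circle.exp (α k)

/-- The index of a symmetric loop, computed with a phase `α`. -/
def loopIndex (A : C(UnitAddCircle, U m)) (α : ℝ → ℝ) : ℂ :=
  Complex.exp (Complex.I * (α 0 : ℂ) / 2) / pfaffian (A 0).1 *
    (Complex.exp (Complex.I * (α (1 / 2) : ℂ) / 2) / pfaffian (A ((1 / 2 : ℝ) : UnitAddCircle)).1)

theorem det_J (m : ℕ) : (J m).det = 1 := by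
  have h : J m = Matrix.fromBlocks 1 1 0 1 * Matrix.fromBlocks 1 0 (-1) 1 *
      Matrix.fromBlocks 1 1 0 1 := by
    simp [J, Matrix.fromBlocks_multiply]
  rw [h, Matrix.det_mul, Matrix.det_mul, Matrix.det_fromBlocks_zero₂₁,
    Matrix.det_fromBlocks_zero₁₂]
  simp

/-- By congruence this reduces to `J`: both sides are multiplied by the square of a determinant. -/
theorem pfaffian_sq {A : Matrix (Fin m ⊕ Fin m) (Fin m ⊕ Fin m) ℂ}
    (hA : A ∈ Matrix.unitaryGroup (Fin m ⊕ Fin m) ℂ) (hA' : Aᵀ = -A) :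
    pfaffian A ^ 2 = A.det := by
  obtain ⟨V, rfl⟩ := exists_eq_transpose_mul_J_mul hA hA'
  rw [pfaffian_transpose_mul_mul, mul_pow, pfaffian_J_sq, Matrix.det_mul, Matrix.det_mul,
    Matrix.det_transpose, det_J]
  ring

theorem transpose_eq_neg_zero {A : C(UnitAddCircle, U m)} (hA : A ∈ symLoop m) :
    (A 0).1ᵀ = -(A 0).1 := by
  have := hA 0
  rw [neg_zero] at this
  rw [this, neg_neg, ← this]

theorem neg_coe_half : -((1 / 2 : ℝ) : UnitAddCircle) = ((1 / 2 : ℝ) : UnitAddCircle) := by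
  rw [neg_eq_iff_add_eq_zero, ← AddCircle.coe_add]
  norm_num

theorem transpose_eq_neg_half {A : C(UnitAddCircle, U m)} (hA : A ∈ symLoop m) :
    (A ((1 / 2 : ℝ) : UnitAddCircle)).1ᵀ = -(A ((1 / 2 : ℝ) : UnitAddCircle)).1 := by
  have := hA ((1 / 2 : ℝ) : UnitAddCircle)
  rw [neg_coe_half] at this
  rw [this, neg_neg, ← this]

theorem continuous_pfaffian :
    Continuous (pfaffian : Matrix (Fin m ⊕ Fin m) (Fin m ⊕ Fin m) ℂ → ℂ) := by
  unfold pfaffian pfaffianFin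
  simp only [Matrix.reindex_apply, Matrix.submatrix_apply]
  refine continuous_const.mul (continuous_finsetSum _ fun σ _ => continuous_const.mul
    (continuous_finsetProd _ fun i _ => ?_))
  exact continuous_id.matrix_elem _ _

theorem pfaffian_ne_zero {A : Matrix (Fin m ⊕ Fin m) (Fin m ⊕ Fin m) ℂ}
    (hA : A ∈ Matrix.unitaryGroup (Fin m ⊕ Fin m) ℂ) (hA' : Aᵀ = -A) : pfaffian A ≠ 0 := by
  intro h
  have h1 := pfaffian_sq hA hA'
  have h2 : ‖A.det‖ = 1 := Circle.norm_coe (detU ⟨A, hA⟩)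
  rw [← h1, h] at h2
  simp at h2

theorem cexp_half_sq (x : ℝ) :
    Complex.exp (Complex.I * (x : ℂ) / 2) ^ 2 = (Circle.exp x : ℂ) := by
  rw [← Complex.exp_nat_mul, Circle.coe_exp]
  congr 1; push_cast; ring

theorem loopIndex_sq {A : C(UnitAddCircle, U m)} (hA : A ∈ symLoop m) {α : ℝ → ℝ}
    (hα : IsLoopPhase A α) : loopIndex A α ^ 2 = 1 := by
  have h0 := hα.2 0 (by norm_num)
  have h1 := hα.2 (1 / 2) (by norm_num)
  have e0 := pfaffian_sq (A 0).2 (transpose_eq_neg_zero hA)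
  have e1 := pfaffian_sq (A ((1 / 2 : ℝ) : UnitAddCircle)).2 (transpose_eq_neg_half hA)
  have n0 := pfaffian_ne_zero (A 0).2 (transpose_eq_neg_zero hA)
  have n1 := pfaffian_ne_zero (A ((1 / 2 : ℝ) : UnitAddCircle)).2 (transpose_eq_neg_half hA)
  rw [loopIndex, mul_pow, div_pow, div_pow, cexp_half_sq, cexp_half_sq, ← h0, ← h1, e0, e1,
    detU_coe, detU_coe, AddCircle.coe_zero, div_self, div_self, one_mul]
  · rw [← e1]; exact pow_ne_zero _ n1
  · rw [← e0]; exact pow_ne_zero _ n0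

/-- The two half-phases have the same square and no zeros on an interval, so they differ by one
global sign. It occurs at both end points and cancels. -/
theorem loopIndex_congr {A : C(UnitAddCircle, U m)} {α α' : ℝ → ℝ} (hα : IsLoopPhase A α)
    (hα' : IsLoopPhase A α') : loopIndex A α = loopIndex A α' := by
  have hc {α : ℝ → ℝ} (hα : IsLoopPhase A α) :
      ContinuousOn (fun k => Complex.exp (Complex.I * (α k : ℂ) / 2)) (Set.Icc 0 (1 / 2)) := by
    have := hα.1
    fun_prop
  have h0 : (0 : ℝ) ∈ Set.Icc (0 : ℝ) (1 / 2) := by norm_num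
  have h1 : (1 / 2 : ℝ) ∈ Set.Icc (0 : ℝ) (1 / 2) := by norm_num
  rcases isPreconnected_Icc.eq_or_eq_neg_of_sq_eq (hc hα) (hc hα') (fun k hk => by
    simp only [Pi.pow_apply]
    rw [cexp_half_sq, cexp_half_sq, ← hα.2 k hk, hα'.2 k hk]) (fun _ => Complex.exp_ne_zero _)
    with h | h
  · have e0 := h h0
    have e1 := h h1
    simp only at e0 e1
    rw [loopIndex, e0, e1, loopIndex]
  · have e0 := h h0
    have e1 := h h1
    simp only [Pi.neg_apply] at e0 e1
    rw [loopIndex, e0, e1, loopIndex]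
    ring

theorem exists_isLoopPhase (A : C(UnitAddCircle, U m)) : ∃ α, IsLoopPhase A α := by
  obtain ⟨α, hα⟩ := exists_path_lift ((detLoop A).comp
    ⟨fun t : unitInterval => (((t : ℝ) / 2 : ℝ) : UnitAddCircle),
      (AddCircle.continuous_mk' 1).comp (by fun_prop)⟩)
  replace hα : ∀ t : unitInterval, Circle.exp (α t) = detU (A (((t : ℝ) / 2 : ℝ) : UnitAddCircle)) :=
    hα
  refine ⟨fun k => α (Set.projIcc 0 1 zero_le_one (2 * k)), by fun_prop, fun k hk => ?_⟩
  have hk' : 2 * k ∈ Set.Icc (0 : ℝ) 1 := ⟨by linarith [hk.1], by linarith [hk.2]⟩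
  simp only [Set.projIcc_of_mem zero_le_one hk', hα]
  congr 3
  simp

/-- Lifting the whole homotopy of determinants to `ℝ` gives phases continuous in the parameter. The
index is then a continuous function with values ±1 on an interval. -/
theorem loopIndex_eq_of_joinedIn {A₀ A₁ : C(UnitAddCircle, U m)} (h : JoinedIn (symLoop m) A₀ A₁)
    {α₀ α₁ : ℝ → ℝ} (hα₀ : IsLoopPhase A₀ α₀) (hα₁ : IsLoopPhase A₁ α₁) :
    loopIndex A₀ α₀ = loopIndex A₁ α₁ := by
  obtain ⟨γ, hγ⟩ := h
  have hγc : Continuous fun p : unitInterval × UnitAddCircle => γ p.1 p.2 :=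
    ContinuousMap.continuous_uncurry_of_continuous γ.toContinuousMap
  let H : C(unitInterval × unitInterval, Circle) :=
    ⟨fun p => detU (γ p.1 (((p.2 : ℝ) / 2 : ℝ) : UnitAddCircle)),
      continuous_detU.comp (hγc.comp (continuous_fst.prodMk
        ((AddCircle.continuous_mk' 1).comp (by fun_prop))))⟩
  obtain ⟨f, hf⟩ := exists_path_lift (H.comp ((ContinuousMap.const unitInterval 0).prodMk
    (ContinuousMap.id unitInterval)))
  let F := Circle.isCoveringMap_exp.liftHomotopy H f fun a => (hf a).symm
  have hF (s x : unitInterval) : Circle.exp (F (s, x)) =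
      detU (γ s (((x : ℝ) / 2 : ℝ) : UnitAddCircle)) :=
    congrFun (Circle.isCoveringMap_exp.liftHomotopy_lifts H f fun a => (hf a).symm) (s, x)
  let α : unitInterval → ℝ → ℝ := fun s k => F (s, Set.projIcc 0 1 zero_le_one (2 * k))
  have hα (s) : IsLoopPhase (γ s) (α s) := by
    refine ⟨by fun_prop, fun k hk => ?_⟩
    have hk' : 2 * k ∈ Set.Icc (0 : ℝ) 1 := ⟨by linarith [hk.1], by linarith [hk.2]⟩
    simp only [α, Set.projIcc_of_mem zero_le_one hk', hF]
    congr 3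
    simp
  have hα0 (k) : Continuous fun s => α s k := by fun_prop
  have hγk (k) : Continuous fun s => pfaffian (γ s k).1 :=
    continuous_pfaffian.comp (continuous_subtype_val.comp
      (hγc.comp (continuous_id.prodMk continuous_const)))
  have hcont : Continuous fun s => loopIndex (γ s) (α s) := by
    unfold loopIndex
    have h0 := hα0 0
    have h1 := hα0 (1 / 2)
    refine Continuous.mul (Continuous.div (by fun_prop) (hγk _) fun s =>
      pfaffian_ne_zero (γ s _).2 (transpose_eq_neg_zero (hγ s))) (Continuous.div (by fun_prop)
        (hγk _) fun s => pfaffian_ne_zero (γ s _).2 (transpose_eq_neg_half (hγ s)))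
  have key : loopIndex (γ 0) (α 0) = loopIndex (γ 1) (α 1) := by
    rcases isPreconnected_univ.eq_or_eq_neg_of_sq_eq hcont.continuousOn
      (continuousOn_const (c := (1 : ℂ))) (fun s _ => by
        simp only [Pi.pow_apply, one_pow]; exact loopIndex_sq (hγ s) (hα s))
      (fun _ => one_ne_zero) with h | h
    · exact (h (Set.mem_univ 0)).trans (h (Set.mem_univ 1)).symm
    · exact (h (Set.mem_univ 0)).trans (h (Set.mem_univ 1)).symm
  have e0 := hα 0
  have e1 := hα 1
  rw [γ.source] at e0 key
  rw [γ.target] at e1 key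
  rw [loopIndex_congr hα₀ e0, key, loopIndex_congr hα₁ e1]

end SymmetricLoops

/-! ### Congruence of symmetric loops and their classification -/

section SymmetricLoops

variable {m : ℕ}

theorem continuous_transposeU :
    Continuous (Matrix.UnitaryGroup.transpose : U m → U m) :=
  Continuous.subtype_mk continuous_subtype_val.matrix_transpose _

/-- The congruence transform `W(-k)ᵀ A(k) W(k)`. -/
def gauge (W A : C(UnitAddCircle, U m)) : C(UnitAddCircle, U m) :=
  ⟨fun k => Matrix.UnitaryGroup.transpose (W (-k)) * A k * W k,
    ((continuous_transposeU.comp (W.continuous.comp continuous_neg)).mul A.continuous).mul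
      W.continuous⟩

theorem gauge_apply (W A : C(UnitAddCircle, U m)) (k : UnitAddCircle) :
    (gauge W A k).1 = (W (-k)).1ᵀ * (A k).1 * (W k).1 := rfl

theorem gauge_one (A : C(UnitAddCircle, U m)) : gauge 1 A = A := by
  ext1 k
  refine Subtype.ext ?_
  rw [gauge_apply]
  simp

theorem gauge_mem {A : C(UnitAddCircle, U m)} (hA : A ∈ symLoop m) (W : C(UnitAddCircle, U m)) :
    gauge W A ∈ symLoop m := fun k => by
  rw [gauge_apply, gauge_apply, hA, Matrix.transpose_mul, Matrix.transpose_mul, neg_neg,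
    Matrix.transpose_transpose, Matrix.mul_neg, Matrix.neg_mul, Matrix.mul_assoc]

/-- Any `W` preserves the symmetry, so a homotopy of `W` needs no symmetry of its own. -/
theorem joinedIn_gauge {A : C(UnitAddCircle, U m)} (hA : A ∈ symLoop m)
    {W W' : C(UnitAddCircle, U m)} (h : Joined W W') :
    JoinedIn (symLoop m) (gauge W A) (gauge W' A) := by
  obtain ⟨γ⟩ := h
  have hγ : Continuous fun p : unitInterval × UnitAddCircle => γ p.1 p.2 :=
    ContinuousMap.continuous_uncurry_of_continuous γ.toContinuousMap
  have hγ' : Continuous fun p : unitInterval × UnitAddCircle => γ p.1 (-p.2) :=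
    hγ.comp (continuous_fst.prodMk continuous_snd.neg)
  refine ⟨{ toContinuousMap := ContinuousMap.curry ⟨fun p : unitInterval × UnitAddCircle =>
                Matrix.UnitaryGroup.transpose (γ p.1 (-p.2)) * A p.2 * γ p.1 p.2, ?_⟩
            source' := ?_
            target' := ?_ }, fun s => ?_⟩
  · exact ((continuous_transposeU.comp hγ').mul (A.continuous.comp continuous_snd)).mul hγ
  · ext1 k; simp [gauge]
  · ext1 k; simp [gauge]
  · exact gauge_mem hA (γ s)

theorem joinedIn_gauge_one {A : C(UnitAddCircle, U m)} (hA : A ∈ symLoop m)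
    {W : C(UnitAddCircle, U m)} (h : Joined 1 W) : JoinedIn (symLoop m) A (gauge W A) := by
  simpa only [gauge_one] using joinedIn_gauge hA h

/-- The constant loop `J`. -/
def constJ (m : ℕ) : C(UnitAddCircle, U m) := ContinuousMap.const _ ⟨J m, J_mem_unitary m⟩

theorem constJ_mem (m : ℕ) : constJ m ∈ symLoop m := fun k => by
  simp [constJ, J_transpose]

/-- The map of degree one of the circle to itself which is constant on half of the circle. -/
def halfMap : C(UnitAddCircle, UnitAddCircle) :=
  ⟨fun k => k + ((‖k‖ : ℝ) : UnitAddCircle),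
    continuous_id.add ((AddCircle.continuous_mk' 1).comp continuous_norm)⟩

theorem norm_coe_of_mem {x : ℝ} (hx : x ∈ Set.Icc (0 : ℝ) (1 / 2)) : ‖(x : UnitAddCircle)‖ = x := by
  rw [(AddCircle.norm_coe_eq_abs_iff (1 : ℝ) one_ne_zero).2, abs_of_nonneg hx.1]
  rw [abs_of_nonneg hx.1, abs_one]
  exact hx.2

theorem halfMap_coe {x : ℝ} (hx : x ∈ Set.Icc (0 : ℝ) (1 / 2)) :
    halfMap (x : UnitAddCircle) = ((2 * x : ℝ) : UnitAddCircle) := by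
  change (x : UnitAddCircle) + _ = _
  rw [norm_coe_of_mem hx, ← AddCircle.coe_add, two_mul]

theorem halfMap_neg_coe {x : ℝ} (hx : x ∈ Set.Icc (0 : ℝ) (1 / 2)) :
    halfMap (-(x : UnitAddCircle)) = 0 := by
  change -(x : UnitAddCircle) + _ = _
  rw [norm_neg, norm_coe_of_mem hx, neg_add_cancel]

theorem exists_coe_eq_or_neg (k : UnitAddCircle) : ∃ x ∈ Set.Icc (0 : ℝ) (1 / 2),
    k = (x : UnitAddCircle) ∨ k = -(x : UnitAddCircle) := by
  obtain ⟨x, hx, rfl⟩ : ∃ x ∈ Set.Ico (0 : ℝ) 1, (x : UnitAddCircle) = k := by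
    have := AddCircle.coe_image_Ico_eq (1 : ℝ) 0
    have h2 : k ∈ ((↑) : ℝ → UnitAddCircle) '' Set.Ico 0 (0 + 1) := by rw [this]; trivial
    simpa using h2
  rcases le_total x (1 / 2) with h | h
  · exact ⟨x, ⟨hx.1, h⟩, Or.inl rfl⟩
  · refine ⟨1 - x, ⟨by linarith [hx.2], by linarith⟩, Or.inr ?_⟩
    rw [AddCircle.coe_sub, AddCircle.coe_period, zero_sub, neg_neg]

/-- The symmetric loop made from an arbitrary loop. -/
def double (β : C(UnitAddCircle, U m)) : C(UnitAddCircle, U m) :=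
  gauge (β.comp halfMap) (constJ m)

theorem double_mem (β : C(UnitAddCircle, U m)) : double β ∈ symLoop m :=
  gauge_mem (constJ_mem m) _

theorem joinedIn_double {β β' : C(UnitAddCircle, U m)} (h : Joined β β') :
    JoinedIn (symLoop m) (double β) (double β') :=
  joinedIn_gauge (constJ_mem m) (h.map (ContinuousMap.continuous_precomp halfMap))

theorem double_coe (β : C(UnitAddCircle, U m)) {x : ℝ} (hx : x ∈ Set.Icc (0 : ℝ) (1 / 2)) :
    (double β (x : UnitAddCircle)).1 =
      (β 0).1ᵀ * J m * (β ((2 * x : ℝ) : UnitAddCircle)).1 := by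
  rw [double, gauge_apply, ContinuousMap.comp_apply, ContinuousMap.comp_apply, halfMap_coe hx,
    halfMap_neg_coe hx]
  rfl

/-- The end points are `VᵢᵀJVᵢ`. A path from `V₀⁻¹` to `V₁⁻¹`, run along both halves of the circle
at once by means of `2‖k‖`, undoes both; being traversed there and back, it is null-homotopic. -/
theorem exists_gauge_eq_J {A : C(UnitAddCircle, U m)} (hA : A ∈ symLoop m) :
    ∃ V : C(UnitAddCircle, U m), Joined 1 V ∧ (gauge V A 0).1 = J m ∧
      (gauge V A ((1 / 2 : ℝ) : UnitAddCircle)).1 = J m := by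
  obtain ⟨V₀, h₀⟩ := exists_eq_transpose_mul_J_mul (A 0).2 (transpose_eq_neg_zero hA)
  obtain ⟨V₁, h₁⟩ := exists_eq_transpose_mul_J_mul (A ((1 / 2 : ℝ) : UnitAddCircle)).2
    (transpose_eq_neg_half hA)
  obtain ⟨γ⟩ := joined_unitaryGroup V₀⁻¹ V₁⁻¹
  obtain ⟨δ⟩ := joined_unitaryGroup 1 V₀⁻¹
  have key (V : U m) : (V⁻¹).1ᵀ * (V.1ᵀ * J m * V.1) * (V⁻¹).1 = J m := by
    have h1 : V.1 * (V⁻¹).1 = 1 := by rw [← Submonoid.coe_mul, mul_inv_cancel, Submonoid.coe_one]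
    have h2 : (V⁻¹).1ᵀ * V.1ᵀ = 1 := by rw [← Matrix.transpose_mul, h1, Matrix.transpose_one]
    calc _ = ((V⁻¹).1ᵀ * V.1ᵀ) * J m * (V.1 * (V⁻¹).1) := by simp only [Matrix.mul_assoc]
      _ = J m := by rw [h1, h2, Matrix.one_mul, Matrix.mul_one]
  let V : C(UnitAddCircle, U m) := ⟨fun k => γ.extend (2 * ‖k‖), by fun_prop⟩
  refine ⟨V, ?_, ?_, ?_⟩
  · have h1 : Joined (1 : C(UnitAddCircle, U m)) (ContinuousMap.const _ V₀⁻¹) :=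
      (joined_unitaryGroup 1 V₀⁻¹).map ContinuousMap.continuous_const'
    refine h1.trans (joined_of_continuous_uncurry (fun s k => γ.extend (s * (2 * ‖k‖))) ?_ ?_ ?_)
    · fun_prop
    · intro k; simp
    · intro k; simp [V]
  · rw [gauge_apply, ← h₀]
    simp only [V, ContinuousMap.coe_mk, neg_zero, norm_zero, mul_zero, Path.extend_zero]
    exact key V₀
  · rw [gauge_apply, ← h₁, neg_coe_half]
    have : V ((1 / 2 : ℝ) : UnitAddCircle) = V₁⁻¹ := by
      simp only [V, ContinuousMap.coe_mk]
      rw [norm_coe_of_mem (by norm_num)]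
      simp
    rw [this]
    exact key V₁

/-- `J⁻¹A` takes the value 1 at 0 and at 1/2, so its restriction to half the circle, run at double
speed, closes up to a loop `β`. The other half of `A` is forced by the symmetry. -/
theorem exists_eq_double {A : C(UnitAddCircle, U m)} (hA : A ∈ symLoop m) (h₀ : (A 0).1 = J m)
    (h₁ : (A ((1 / 2 : ℝ) : UnitAddCircle)).1 = J m) :
    ∃ β : C(UnitAddCircle, U m), A = double β ∧
      ∀ x ∈ Set.Icc (0 : ℝ) (1 / 2), detU (β ((2 * x : ℝ) : UnitAddCircle)) = detU (A x) := by
  set JU : U m := ⟨J m, J_mem_unitary m⟩ with hJU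
  let f : ℝ → U m := fun x => JU⁻¹ * A ((x / 2 : ℝ) : UnitAddCircle)
  have hf : Continuous f := continuous_const.mul (A.continuous.comp
    ((AddCircle.continuous_mk' 1).comp (by fun_prop)))
  have hA0 : A 0 = JU := Subtype.ext h₀
  have hA1 : A ((1 / 2 : ℝ) : UnitAddCircle) = JU := Subtype.ext h₁
  have hf0 : f 0 = 1 := by simp [f, hA0]
  have hf1 : f 1 = 1 := by simp only [f]; rw [hA1, inv_mul_cancel]
  let β : C(UnitAddCircle, U m) := ⟨AddCircle.liftIco 1 0 f,
    AddCircle.liftIco_zero_continuous (hf0.trans hf1.symm) hf.continuousOn⟩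
  have hβ (x : ℝ) (hx : x ∈ Set.Icc (0 : ℝ) (1 / 2)) :
      β ((2 * x : ℝ) : UnitAddCircle) = JU⁻¹ * A x := by
    change AddCircle.liftIco 1 0 f _ = _
    rcases eq_or_lt_of_le hx.2 with rfl | h
    · have : ((2 * (1 / 2) : ℝ) : UnitAddCircle) = ((0 : ℝ) : UnitAddCircle) := by norm_num
      rw [this, AddCircle.liftIco_zero_coe_apply (by norm_num), hf0, hA1, inv_mul_cancel]
    · rw [AddCircle.liftIco_zero_coe_apply ⟨by linarith [hx.1], by linarith⟩]
      simp [f]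
  have hβ0 : β 0 = 1 := by
    have := hβ 0 (by norm_num)
    rw [mul_zero, AddCircle.coe_zero, hA0, inv_mul_cancel] at this
    exact this
  have hdJ : detU JU = 1 := by ext1; exact det_J m
  have hval (x : ℝ) (hx : x ∈ Set.Icc (0 : ℝ) (1 / 2)) : (A x).1 = (double β x).1 := by
    rw [double_coe β hx, hβ0, hβ x hx, Submonoid.coe_one, Matrix.transpose_one, Matrix.one_mul,
      show J m = JU.1 from rfl, ← Submonoid.coe_mul, mul_inv_cancel_left]
  refine ⟨β, ?_, fun x hx => by rw [hβ x hx, map_mul, map_inv, hdJ, inv_one, one_mul]⟩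
  ext1 k
  refine Subtype.ext ?_
  obtain ⟨x, hx, rfl | rfl⟩ := exists_coe_eq_or_neg k
  · exact hval x hx
  · rw [hA, double_mem β, hval x hx]

/-- The phase is `2θ(0)` at 0 and `2θ(0) + 2πw` at 1/2, while both Pfaffians are `e^{iθ(0)} Pf J`.
Halving the phase leaves `e^{iπw}`. -/
theorem loopIndex_double (β : C(UnitAddCircle, U m)) (w : ℤ) (θ : C(UnitAddCircle, ℝ))
    (hβ : ∀ t, detU (β t) = AddCircle.toCircle t ^ w * Circle.exp (θ t)) {α : ℝ → ℝ}
    (hα : IsLoopPhase (double β) α) : loopIndex (double β) α = (-1) ^ w := by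
  have hph : IsLoopPhase (double β)
      (fun x => θ 0 + (w * (2 * Real.pi * (2 * x)) + θ ((2 * x : ℝ) : UnitAddCircle))) := by
    refine ⟨Continuous.continuousOn (continuous_const.add (Continuous.add (by fun_prop)
      (θ.continuous.comp ((AddCircle.continuous_mk' 1).comp (by fun_prop))))), fun x hx => ?_⟩
    ext1
    rw [detU_coe, double_coe β hx, Matrix.det_mul, Matrix.det_mul, Matrix.det_transpose, det_J,
      mul_one, ← detU_coe, ← detU_coe, hβ, hβ, Circle.exp_add, Circle.exp_add,
      Circle.exp_intCast_mul, AddCircle.toCircle_apply_mk]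
    simp
  have hpf (x : ℝ) (hx : x = 0 ∨ x = 1 / 2) :
      pfaffian (double β x).1 = Circle.exp (θ 0) * pfaffian (J m) := by
    have h0 : ((2 * x : ℝ) : UnitAddCircle) = 0 := by
      rcases hx with rfl | rfl <;> norm_num
    have hx' : x ∈ Set.Icc (0 : ℝ) (1 / 2) := by rcases hx with rfl | rfl <;> norm_num
    rw [double_coe β hx', h0, pfaffian_transpose_mul_mul, ← detU_coe, hβ]
    simp
  rw [loopIndex_congr hα hph, loopIndex]
  have e0 := hpf 0 (Or.inl rfl)
  rw [AddCircle.coe_zero] at e0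
  have hJ := pfaffian_J_sq m
  have hJ0 : pfaffian (J m) ≠ 0 := fun h => by rw [h] at hJ; norm_num at hJ
  have h1 : ((2 * (1 / 2) : ℝ) : UnitAddCircle) = 0 := by norm_num
  rw [e0, hpf _ (Or.inr rfl), h1, Circle.coe_exp, div_mul_div_comm, ← Complex.exp_add]
  have h2 : Complex.exp ((θ 0 : ℂ) * Complex.I) * pfaffian (J m) *
      (Complex.exp ((θ 0 : ℂ) * Complex.I) * pfaffian (J m)) =
      Complex.exp ((θ 0 : ℂ) * Complex.I + (θ 0 : ℂ) * Complex.I) := by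
    rw [Complex.exp_add]; linear_combination (Complex.exp ((θ 0 : ℂ) * Complex.I)) ^ 2 * hJ
  rw [h2, ← Complex.exp_sub, ← Complex.exp_pi_mul_I, ← Complex.exp_int_mul]
  congr 1
  simp
  ring

/-- The homotopy classification of symmetric loops. -/
theorem joinedIn_symLoop_iff {A₀ A₁ : C(UnitAddCircle, U m)} (h₀ : A₀ ∈ symLoop m)
    (h₁ : A₁ ∈ symLoop m) {α₀ α₁ : ℝ → ℝ} (hα₀ : IsLoopPhase A₀ α₀) (hα₁ : IsLoopPhase A₁ α₁) :
    JoinedIn (symLoop m) A₀ A₁ ↔ loopIndex A₀ α₀ = loopIndex A₁ α₁ := by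
  refine ⟨fun h => loopIndex_eq_of_joinedIn h hα₀ hα₁, fun h => ?_⟩
  -- For `m = 0` there is no diagonal entry with which to adjust the winding, but there is also only
  -- one loop.
  rcases isEmpty_or_nonempty (Fin m ⊕ Fin m) with hm | ⟨⟨i₀⟩⟩
  · have : A₀ = A₁ := by ext t i; exact isEmptyElim i
    rw [this]
    exact JoinedIn.refl h₁
  -- Each symmetric loop is homotopic to doubled loops whose windings differ by an arbitrary even
  -- number `2c`.
  have hnf {A : C(UnitAddCircle, U m)} (hA : A ∈ symLoop m) : ∃ z : C(UnitAddCircle, Circle),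
      ∀ c : ℤ, ∃ β, JoinedIn (symLoop m) A (double β) ∧
        ∀ t, detU (β t) = AddCircle.toCircle t ^ (2 * c) * z t := by
    obtain ⟨V, hV, e0, e1⟩ := exists_gauge_eq_J hA
    obtain ⟨β, hβ, hdβ⟩ := exists_eq_double (gauge_mem hA V) e0 e1
    refine ⟨detLoop β, fun c => ?_⟩
    -- It is even in `k` and equal to 1 at both 0 and 1/2, so the end points stay at `J`. On the
    -- half circle `det W` winds `c` times and enters the congruence twice.
    let W : C(UnitAddCircle, U m) := ⟨fun k => diagU i₀ (Circle.exp (4 * Real.pi * c * ‖k‖)),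
      (continuous_diagU i₀).comp (by fun_prop)⟩
    have hW : Joined 1 W := by
      refine joined_of_continuous_uncurry
        (fun s k => diagU i₀ (Circle.exp (s * (4 * Real.pi * c * ‖k‖)))) ?_ ?_ ?_
      · exact (continuous_diagU i₀).comp (by fun_prop)
      · intro k; simp
      · intro k; simp [W]
    have hW0 : W 0 = 1 := by simp [W]
    have hW1 : W ((1 / 2 : ℝ) : UnitAddCircle) = 1 := by
      simp only [W, ContinuousMap.coe_mk]
      rw [norm_coe_of_mem (by norm_num), show 4 * Real.pi * c * (1 / 2 : ℝ) = c * (2 * Real.pi) by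
        ring, Circle.exp_int_mul_two_pi, map_one]
    have f0 : (gauge W (gauge V A) 0).1 = J m := by
      rw [gauge_apply, e0, neg_zero, hW0]; simp
    have f1 : (gauge W (gauge V A) ((1 / 2 : ℝ) : UnitAddCircle)).1 = J m := by
      rw [gauge_apply, e1, neg_coe_half, hW1]; simp
    obtain ⟨β', hβ', hdβ'⟩ := exists_eq_double (gauge_mem (gauge_mem hA V) W) f0 f1
    refine ⟨β', ?_, fun t => ?_⟩
    · rw [← hβ']
      exact (joinedIn_gauge_one hA hV).trans (joinedIn_gauge_one (gauge_mem hA V) hW)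
    · obtain ⟨y, hy, rfl⟩ : ∃ y ∈ Set.Ico (0 : ℝ) 1, (y : UnitAddCircle) = t := by
        have := AddCircle.coe_image_Ico_eq (1 : ℝ) 0
        have h2 : t ∈ ((↑) : ℝ → UnitAddCircle) '' Set.Ico 0 (0 + 1) := by rw [this]; trivial
        simpa using h2
      obtain ⟨x, rfl⟩ : ∃ x, y = 2 * x := ⟨y / 2, by ring⟩
      have hx : x ∈ Set.Icc (0 : ℝ) (1 / 2) := ⟨by linarith [hy.1], by linarith [hy.2]⟩
      have hWx : detU (W x) = Circle.exp (2 * Real.pi * (2 * x)) ^ c := by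
        simp only [W, ContinuousMap.coe_mk]
        rw [norm_coe_of_mem hx, detU_diagU, ← Circle.exp_intCast_mul]
        congr 1; ring
      have hWx' : detU (W (-x)) = detU (W x) := by simp [W]
      have htr (u : U m) : detU (Matrix.UnitaryGroup.transpose u) = detU u := by
        ext1; exact Matrix.det_transpose _
      have hg : gauge W (gauge V A) x =
        Matrix.UnitaryGroup.transpose (W (-x)) * gauge V A x * W x := rfl
      change _ = _ * detU (β _)
      rw [hdβ' x hx, hdβ x hx, hg, map_mul, map_mul, htr, hWx', hWx, AddCircle.toCircle_apply_mk,
        div_one, two_mul c, zpow_add]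
      ac_rfl
  obtain ⟨z₀, hz₀⟩ := hnf h₀
  obtain ⟨z₁, hz₁⟩ := hnf h₁
  obtain ⟨w₀, θ₀, hw₀⟩ := exists_winding z₀
  obtain ⟨w₁, θ₁, hw₁⟩ := exists_winding z₁
  have hidx {A : C(UnitAddCircle, U m)} {α : ℝ → ℝ} (hα : IsLoopPhase A α)
      {z : C(UnitAddCircle, Circle)} (hz : ∀ c : ℤ, ∃ β, JoinedIn (symLoop m) A (double β) ∧
        ∀ t, detU (β t) = AddCircle.toCircle t ^ (2 * c) * z t) {w : ℤ} {θ : C(UnitAddCircle, ℝ)}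
      (hw : ∀ t, z t = AddCircle.toCircle t ^ w * Circle.exp (θ t)) :
      loopIndex A α = (-1) ^ w := by
    obtain ⟨β, hβ, hd⟩ := hz 0
    obtain ⟨α', hα'⟩ := exists_isLoopPhase (double β)
    rw [loopIndex_eq_of_joinedIn hβ hα hα']
    exact loopIndex_double β w θ (fun t => by rw [hd, hw]; simp) hα'
  rw [hidx hα₀ hz₀ hw₀, hidx hα₁ hz₁ hw₁] at h
  have hev : Even (w₁ - w₀) := by
    by_contra hodd
    rw [Int.not_even_iff_odd] at hodd
    have h2 : (-1 : ℂ) ^ (w₁ - w₀) = 1 := by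
      rw [zpow_sub₀ (by norm_num), h, div_self (zpow_ne_zero _ (by norm_num))]
    rw [hodd.neg_one_zpow] at h2
    norm_num at h2
  obtain ⟨c, hc⟩ := hev
  -- As `w₁ = w₀ + 2c`, shifting only the first loop equalizes the windings, and the determinant of
  -- the quotient has a logarithm.
  obtain ⟨β₀, hβ₀, hd₀⟩ := hz₀ c
  obtain ⟨β₁, hβ₁, hd₁⟩ := hz₁ 0
  have hj : Joined (β₀ * β₁⁻¹) 1 := by
    refine joined_one_of_detLoop_eq_exp _ (θ₀ - θ₁) fun t => ?_
    rw [ContinuousMap.mul_apply, ContinuousMap.inv_apply, map_mul, map_inv, hd₀, hd₁, hw₀, hw₁,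
      show w₁ = 2 * c + w₀ by omega, zpow_add, ContinuousMap.sub_apply, Circle.exp_sub]
    rw [mul_zero, zpow_zero, one_mul, ← div_eq_mul_inv, ← mul_assoc, mul_div_mul_left_eq_div]
  have hj' : Joined β₀ β₁ := by simpa using hj.mul (Joined.refl β₁)
  exact hβ₀.trans ((joinedIn_double hj').trans hβ₁.symm)

end SymmetricLoops

/-! ### The symmetries in block form -/

section NormalForm

variable {H : Type*} [NormedAddCommGroup H] [InnerProductSpace ℂ H]

/-- Intertwining relations of a conjugate-linear operator in terms of matrices. -/
theorem antilinear_comm_iff {ι : Type*} [Fintype ι] [DecidableEq ι] {b : OrthonormalBasis ι ℂ H}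
    {T : H ≃ₗᵢ⋆[ℂ] H} {N : Matrix ι ι ℂ} (hT : HasAntilinearMatrix b T N) (A B : H →ₗ[ℂ] H) :
    (∀ x, A (T x) = T (B x)) ↔
      LinearMap.toMatrix b.toBasis b.toBasis A * N =
        N * (LinearMap.toMatrix b.toBasis b.toBasis B).map star := by
  have hA (A : H →ₗ[ℂ] H) (j) : A (b j) =
      ∑ i, LinearMap.toMatrix b.toBasis b.toBasis A i j • b i := by
    conv_lhs => rw [← b.toBasis.sum_repr (A (b j))]
    simp [LinearMap.toMatrix_apply]
  have h1 (j) : A (T (b j)) =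
      ∑ k, (LinearMap.toMatrix b.toBasis b.toBasis A * N) k j • b k := by
    rw [hT j, map_sum]
    simp only [map_smul, hA A, Matrix.mul_apply, Finset.sum_smul, Finset.smul_sum, smul_smul]
    rw [Finset.sum_comm]
    simp only [mul_comm]
  have h2 (j) : T (B (b j)) =
      ∑ k, (N * (LinearMap.toMatrix b.toBasis b.toBasis B).map star) k j • b k := by
    rw [hA B, map_sum]
    simp only [LinearIsometryEquiv.map_smulₛₗ, hT _, Matrix.mul_apply, Finset.sum_smul,
      Finset.smul_sum, smul_smul, Matrix.map_apply]
    rw [Finset.sum_comm]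
    simp only [mul_comm]
    rfl
  constructor
  · intro h
    ext k j
    have h3 := (h1 j).symm.trans ((h (b j)).trans (h2 j))
    have h4 := congrArg (fun x => b.toBasis.repr x k) h3
    simpa [Finsupp.single_apply] using h4
  · intro h x
    have h3 : A.comp (T.toLinearEquiv : H →ₛₗ[starRingEnd ℂ] H) =
        (T.toLinearEquiv : H →ₛₗ[starRingEnd ℂ] H).comp B := by
      refine b.toBasis.ext fun j => ?_
      simpa [h] using (h1 j).trans (by rw [h]; exact (h2 j).symm)
    exact congrArg (fun f : H →ₛₗ[starRingEnd ℂ] H => f x) h3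

/-- The matrix `½ [1, J A; (J A)^*, 1]`. -/
def blockMat {m : ℕ} (A : Matrix (Fin m ⊕ Fin m) (Fin m ⊕ Fin m) ℂ) : Matrix (Idx m) (Idx m) ℂ :=
  (1 / 2 : ℂ) • Matrix.fromBlocks 1 (J m * A) (J m * A)ᴴ 1

theorem J_transpose_mul_J (m : ℕ) : (J m)ᵀ * J m = 1 := by
  rw [J_transpose, Matrix.neg_mul, J_mul_J, neg_neg]

theorem J_mul_J_transpose (m : ℕ) : J m * (J m)ᵀ = 1 := by
  rw [J_transpose, Matrix.mul_neg, J_mul_J, neg_neg]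

theorem J_mul_cancel {m : ℕ} {A B : Matrix (Fin m ⊕ Fin m) (Fin m ⊕ Fin m) ℂ}
    (h : J m * A = J m * B) : A = B := by
  have := congrArg ((J m)ᵀ * ·) h
  simpa only [← Matrix.mul_assoc, J_transpose_mul_J, Matrix.one_mul] using this

theorem mul_J_cancel {m : ℕ} {A B : Matrix (Fin m ⊕ Fin m) (Fin m ⊕ Fin m) ℂ}
    (h : A * J m = B * J m) : A = B := by
  have := congrArg (· * (J m)ᵀ) h
  simpa only [Matrix.mul_assoc, J_mul_J_transpose, Matrix.mul_one] using this

theorem blockMat_isHermitian {m : ℕ} (A : Matrix (Fin m ⊕ Fin m) (Fin m ⊕ Fin m) ℂ) :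
    (blockMat A).IsHermitian := by
  rw [Matrix.IsHermitian, blockMat, Matrix.conjTranspose_smul, Matrix.fromBlocks_conjTranspose]
  simp

theorem blockMat_mul_self {m : ℕ} {A : Matrix (Fin m ⊕ Fin m) (Fin m ⊕ Fin m) ℂ}
    (hA : A ∈ Matrix.unitaryGroup (Fin m ⊕ Fin m) ℂ) : blockMat A * blockMat A = blockMat A := by
  have hQ : J m * A ∈ Matrix.unitaryGroup (Fin m ⊕ Fin m) ℂ := mul_mem (J_mem_unitary m) hA
  have h1 : (J m * A) * (J m * A)ᴴ = 1 := Matrix.mem_unitaryGroup_iff.1 hQ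
  have h2 : (J m * A)ᴴ * (J m * A) = 1 := Matrix.mem_unitaryGroup_iff'.1 hQ
  rw [blockMat, Matrix.smul_mul, Matrix.mul_smul, Matrix.fromBlocks_multiply, h1, h2]
  simp only [Matrix.one_mul, Matrix.mul_one, smul_smul, ← two_smul ℂ, Matrix.fromBlocks_smul]
  norm_num

theorem trace_blockMat {m : ℕ} (A : Matrix (Fin m ⊕ Fin m) (Fin m ⊕ Fin m) ℂ) :
    (blockMat A).trace = ((2 * m : ℕ) : ℂ) := by
  rw [blockMat, Matrix.trace_smul]
  simp only [Matrix.trace, Matrix.diag, Fintype.sum_sum_type, Matrix.fromBlocks_apply₁₁,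
    Matrix.fromBlocks_apply₂₂, Matrix.one_apply_eq, Finset.sum_const, Finset.card_univ,
    Fintype.card_sum, Fintype.card_fin, nsmul_eq_mul, smul_eq_mul]
  push_cast
  ring

theorem blockMat_map_star {m : ℕ} (A : Matrix (Fin m ⊕ Fin m) (Fin m ⊕ Fin m) ℂ) :
    (blockMat A).map star =
      (1 / 2 : ℂ) • Matrix.fromBlocks 1 (J m * A.map star) (-(Aᵀ * J m)) 1 := by
  have h1 : (J m * A).map star = J m * A.map star := by
    have := Matrix.map_mul (L := J m) (M := A) (f := starRingEnd ℂ)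
    exact this.trans (by rw [show (J m).map (starRingEnd ℂ) = J m from J_map_star m]; rfl)
  have h2 : (J m * A)ᴴ.map star = -(Aᵀ * J m) := by
    rw [Matrix.conjTranspose, Matrix.map_map, star_involutive.comp_self, Matrix.map_id,
      Matrix.transpose_mul, J_transpose, Matrix.mul_neg]
  have h3 : (1 : Matrix (Fin m ⊕ Fin m) (Fin m ⊕ Fin m) ℂ).map star = 1 := by
    simp
  have h4 (M : Matrix (Idx m) (Idx m) ℂ) :
      ((1 / 2 : ℂ) • M).map star = (1 / 2 : ℂ) • M.map star := by
    have h2 : (starRingEnd ℂ) 2 = 2 := Complex.conj_ofNat 2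
    ext i j; simp [h2]
  rw [blockMat, h4, Matrix.fromBlocks_map, h1, h2, h3]

theorem one_sub_blockMat_map_star {m : ℕ} (A : Matrix (Fin m ⊕ Fin m) (Fin m ⊕ Fin m) ℂ) :
    (1 - blockMat A).map star =
      (1 / 2 : ℂ) • Matrix.fromBlocks 1 (-(J m * A.map star)) (Aᵀ * J m) 1 := by
  have h : (1 - blockMat A).map star = 1 - (blockMat A).map star := by
    rw [Matrix.map_sub _ (by simp)]; simp
  rw [h, blockMat_map_star, ← Matrix.fromBlocks_one, Matrix.fromBlocks_smul,
    Matrix.fromBlocks_smul, sub_eq_add_neg, Matrix.fromBlocks_neg, Matrix.fromBlocks_add]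
  congr 1
  · module
  · simp
  · simp
  · module

theorem half_smul_inj {n : Type*} {M N : Matrix n n ℂ} :
    (1 / 2 : ℂ) • M = (1 / 2 : ℂ) • N ↔ M = N :=
  (smul_right_injective _ (by norm_num)).eq_iff

theorem conjTranspose_mul_J {m : ℕ} (A : Matrix (Fin m ⊕ Fin m) (Fin m ⊕ Fin m) ℂ) :
    (J m * A)ᴴ * J m = Aᴴ := by
  rw [Matrix.conjTranspose_mul, J_conjTranspose, Matrix.mul_assoc, Matrix.neg_mul, J_mul_J,
    neg_neg, Matrix.mul_one]

theorem conjTranspose_eq_of_eq_neg_transpose {m : ℕ}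
    {A A' : Matrix (Fin m ⊕ Fin m) (Fin m ⊕ Fin m) ℂ} (h : A' = -Aᵀ) :
    Aᴴ = J m * (J m * A'.map star) := by
  rw [← Matrix.mul_assoc, J_mul_J, h]
  ext i j
  simp

theorem J_mul_J_eq_iff {m : ℕ} {A A' : Matrix (Fin m ⊕ Fin m) (Fin m ⊕ Fin m) ℂ} :
    J m * A * J m = J m * -(A'ᵀ * J m) ↔ A' = -Aᵀ := by
  rw [← Matrix.neg_mul, ← Matrix.mul_assoc]
  constructor
  · intro h
    rw [J_mul_cancel (mul_J_cancel h)]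
    simp
  · rintro rfl
    simp

/-- The symmetries in terms of the blocks. -/
theorem blockMat_T_symmetry_iff {m : ℕ} (A A' : Matrix (Fin m ⊕ Fin m) (Fin m ⊕ Fin m) ℂ) :
    blockMat A * Matrix.fromBlocks 0 (J m) (J m) 0 =
        Matrix.fromBlocks 0 (J m) (J m) 0 * (blockMat A').map star ↔ A' = -Aᵀ := by
  rw [blockMat_map_star, blockMat, Matrix.smul_mul, Matrix.mul_smul, half_smul_inj,
    Matrix.fromBlocks_multiply, Matrix.fromBlocks_multiply, Matrix.fromBlocks_inj,
    conjTranspose_mul_J]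
  simp only [Matrix.mul_zero, Matrix.zero_mul, Matrix.mul_one, Matrix.one_mul, zero_add, add_zero,
    J_mul_J_eq_iff, true_and]
  exact ⟨fun h => h.1, fun h => ⟨h, conjTranspose_eq_of_eq_neg_transpose h⟩⟩

/-- The block form already contains the chiral symmetry, so `C` follows from `T`. -/
theorem blockMat_C_symmetry {m : ℕ} {A A' : Matrix (Fin m ⊕ Fin m) (Fin m ⊕ Fin m) ℂ}
    (h : A' = -Aᵀ) : blockMat A * Matrix.fromBlocks 0 (J m) (-J m) 0 =
        Matrix.fromBlocks 0 (J m) (-J m) 0 * (1 - blockMat A').map star := by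
  rw [one_sub_blockMat_map_star, blockMat, Matrix.smul_mul, Matrix.mul_smul, half_smul_inj,
    Matrix.fromBlocks_multiply, Matrix.fromBlocks_multiply, Matrix.fromBlocks_inj,
    conjTranspose_mul_J]
  simp only [Matrix.mul_zero, Matrix.zero_mul, Matrix.mul_one, Matrix.one_mul, zero_add, add_zero,
    true_and, Matrix.mul_neg, Matrix.neg_mul, neg_neg]
  have h1 := J_mul_J_eq_iff.2 h
  rw [Matrix.mul_neg] at h1
  exact ⟨by rw [h1, neg_neg], by simp, conjTranspose_eq_of_eq_neg_transpose h⟩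

/-- The diagonal blocks are 1/2 by the two symmetries together, and the corner of `M² = M` then
gives `BB* = 1/2 - 1/4`, so `2B` is unitary. -/
theorem eq_blockMat_of_symmetry {m : ℕ} {M M' : Matrix (Idx m) (Idx m) ℂ} (hM : M.IsHermitian)
    (hMM : M * M = M)
    (hT : M * Matrix.fromBlocks 0 (J m) (J m) 0 = Matrix.fromBlocks 0 (J m) (J m) 0 * M'.map star)
    (hC : M * Matrix.fromBlocks 0 (J m) (-J m) 0 =
      Matrix.fromBlocks 0 (J m) (-J m) 0 * (1 - M').map star) :
    ∃ A ∈ Matrix.unitaryGroup (Fin m ⊕ Fin m) ℂ, M = blockMat A := by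
  have diag {M M' : Matrix (Idx m) (Idx m) ℂ}
      (hT : M * Matrix.fromBlocks 0 (J m) (J m) 0 =
        Matrix.fromBlocks 0 (J m) (J m) 0 * M'.map star)
      (hC : M * Matrix.fromBlocks 0 (J m) (-J m) 0 =
        Matrix.fromBlocks 0 (J m) (-J m) 0 * (1 - M').map star) :
      M.toBlocks₁₁ = (1 / 2 : ℂ) • 1 ∧ M.toBlocks₂₂ = (1 / 2 : ℂ) • 1 := by
    have e : (1 - M').map star = 1 - M'.map star := by
      rw [Matrix.map_sub _ (by simp)]; simp
    rw [e] at hC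
    generalize M'.map star = N at hT hC
    rw [← Matrix.fromBlocks_toBlocks M, ← Matrix.fromBlocks_toBlocks N] at hT hC
    rw [← Matrix.fromBlocks_one, sub_eq_add_neg (Matrix.fromBlocks _ _ _ _),
      Matrix.fromBlocks_neg, Matrix.fromBlocks_add] at hC
    rw [Matrix.fromBlocks_multiply, Matrix.fromBlocks_multiply, Matrix.fromBlocks_inj] at hT hC
    simp only [Matrix.mul_zero, Matrix.zero_mul, neg_zero, zero_add, add_zero, Matrix.mul_neg,
      Matrix.neg_mul, neg_inj] at hT hC
    -- The relations for `T` and `C` have the same left side here, with `N` on the right in one and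
    -- `1 - N` in the other; hence the block of `N` satisfies `X = 1 - X`.
    have h1 := J_mul_cancel (hT.2.1.symm.trans hC.2.1)
    have h2 := J_mul_cancel (hT.2.2.1.symm.trans hC.2.2.1)
    have half {X : Matrix (Fin m ⊕ Fin m) (Fin m ⊕ Fin m) ℂ} (h : X = 1 + -X) :
        X = (1 / 2 : ℂ) • 1 := by
      have : (2 : ℂ) • X = 1 := by rw [two_smul]; nth_rw 1 [h]; simp
      rw [← this, smul_smul]; norm_num
    have fin {X Y : Matrix (Fin m ⊕ Fin m) (Fin m ⊕ Fin m) ℂ} (h : X * J m = J m * Y)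
        (hY : Y = (1 / 2 : ℂ) • 1) : X = (1 / 2 : ℂ) • 1 :=
      mul_J_cancel (by rw [h, hY, Matrix.mul_smul, Matrix.smul_mul, Matrix.mul_one, Matrix.one_mul])
    exact ⟨fin hT.2.1 (half h1), fin hT.2.2.1 (half h2)⟩
  obtain ⟨h11, h22⟩ := diag hT hC
  set B := M.toBlocks₁₂ with hB
  have h21 : M.toBlocks₂₁ = Bᴴ := by
    ext i j
    exact (congrFun (congrFun hM (Sum.inr i)) (Sum.inl j)).symm
  have hMb : M = Matrix.fromBlocks ((1 / 2 : ℂ) • 1) B Bᴴ ((1 / 2 : ℂ) • 1) := by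
    rw [← Matrix.fromBlocks_toBlocks M, h11, h22, h21]
  have hBB : B * Bᴴ = (1 / 4 : ℂ) • 1 := by
    rw [hMb, Matrix.fromBlocks_multiply, Matrix.fromBlocks_inj] at hMM
    have h1 := hMM.1
    rw [Matrix.smul_mul, Matrix.one_mul, smul_smul, ← eq_sub_iff_add_eq', ← sub_smul] at h1
    rw [h1]; norm_num
  have hQ : (2 : ℂ) • B ∈ Matrix.unitaryGroup (Fin m ⊕ Fin m) ℂ := by
    rw [Matrix.mem_unitaryGroup_iff, Matrix.star_eq_conjTranspose, Matrix.conjTranspose_smul,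
      Matrix.smul_mul, Matrix.mul_smul, hBB, smul_smul, smul_smul]
    norm_num
  have hJt : (J m)ᵀ ∈ Matrix.unitaryGroup (Fin m ⊕ Fin m) ℂ :=
    Matrix.transpose_mem_unitaryGroup_iff.2 (J_mem_unitary m)
  refine ⟨(J m)ᵀ * ((2 : ℂ) • B), mul_mem hJt hQ, ?_⟩
  rw [blockMat, ← Matrix.mul_assoc, J_mul_J_transpose, Matrix.one_mul, Matrix.fromBlocks_smul, hMb,
    Matrix.conjTranspose_smul, smul_smul, smul_smul]
  norm_num

end NormalForm

/-! ### From projections to the matrices `A`, and the dimension condition -/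

section NormalForm

variable {H : Type*} [NormedAddCommGroup H] [InnerProductSpace ℂ H]

/-- Membership in `DIII` in terms of the matrices `A(k)`. -/
theorem mem_DIII_iff {m : ℕ} {T C : H ≃ₗᵢ⋆[ℂ] H} {b : OrthonormalBasis (Idx m) ℂ H}
    (hb : IsNormalBasis T C b) {d : ℕ} (P : C(Torus d, H →L[ℂ] H)) :
    P ∈ DIII T C d (2 * m) ↔ ∃ A : Torus d → Matrix (Fin m ⊕ Fin m) (Fin m ⊕ Fin m) ℂ,
      (∀ k, A k ∈ Matrix.unitaryGroup (Fin m ⊕ Fin m) ℂ) ∧ (∀ k, A (-k) = -(A k)ᵀ) ∧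
      ∀ k, LinearMap.toMatrix b.toBasis b.toBasis (P k : H →ₗ[ℂ] H) = blockMat (A k) := by
  have hTk (k) : (∀ x, T.symm (P k (T x)) = P (-k) x) ↔
      LinearMap.toMatrix b.toBasis b.toBasis (P k : H →ₗ[ℂ] H) *
        Matrix.fromBlocks 0 (J m) (J m) 0 = Matrix.fromBlocks 0 (J m) (J m) 0 *
        (LinearMap.toMatrix b.toBasis b.toBasis (P (-k) : H →ₗ[ℂ] H)).map star := by
    rw [← antilinear_comm_iff hb.T_form]
    refine forall_congr' fun x => ?_
    rw [LinearIsometryEquiv.symm_apply_eq]; rfl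
  have hCk (k) : (∀ x, C.symm (P k (C x)) = x - P (-k) x) ↔
      LinearMap.toMatrix b.toBasis b.toBasis (P k : H →ₗ[ℂ] H) *
        Matrix.fromBlocks 0 (J m) (-J m) 0 = Matrix.fromBlocks 0 (J m) (-J m) 0 *
        (1 - LinearMap.toMatrix b.toBasis b.toBasis (P (-k) : H →ₗ[ℂ] H)).map star := by
    rw [← LinearMap.toMatrix_one b.toBasis, ← map_sub, ← antilinear_comm_iff hb.C_form]
    refine forall_congr' fun x => ?_
    rw [LinearIsometryEquiv.symm_apply_eq]; rfl
  have hmul (k) : P k * P k = P k ↔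
      LinearMap.toMatrix b.toBasis b.toBasis (P k : H →ₗ[ℂ] H) *
        LinearMap.toMatrix b.toBasis b.toBasis (P k : H →ₗ[ℂ] H) =
        LinearMap.toMatrix b.toBasis b.toBasis (P k : H →ₗ[ℂ] H) := by
    rw [← LinearMap.toMatrix_mul, (LinearMap.toMatrix b.toBasis b.toBasis).injective.eq_iff,
      ← ContinuousLinearMap.coe_inj]
    rfl
  have hherm (k) := LinearMap.isHermitian_toMatrix_iff (f := (P k : H →ₗ[ℂ] H)) b
  have htr (k) := LinearMap.trace_eq_matrix_trace ℂ b.toBasis (P k : H →ₗ[ℂ] H)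
  constructor
  · rintro ⟨hG, hT, hC⟩
    have h (k) : ∃ A ∈ Matrix.unitaryGroup (Fin m ⊕ Fin m) ℂ,
        LinearMap.toMatrix b.toBasis b.toBasis (P k : H →ₗ[ℂ] H) = blockMat A :=
      eq_blockMat_of_symmetry ((hherm k).2 (hG k).2.1) ((hmul k).1 (hG k).1) ((hTk k).1 (hT k))
        ((hCk k).1 (hC k))
    choose A hAu hA using h
    refine ⟨A, hAu, fun k => ?_, hA⟩
    have := (hTk k).1 (hT k)
    rw [hA, hA] at this
    exact (blockMat_T_symmetry_iff _ _).1 this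
  · rintro ⟨A, hAu, hAs, hA⟩
    refine ⟨fun k => ⟨(hmul k).2 ?_, (hherm k).1 ?_, ?_⟩, fun k => (hTk k).2 ?_,
      fun k => (hCk k).2 ?_⟩
    · rw [hA]; exact blockMat_mul_self (hAu k)
    · rw [hA]; exact blockMat_isHermitian _
    · rw [htr, hA]; exact trace_blockMat _
    · rw [hA, hA]; exact (blockMat_T_symmetry_iff _ _).2 (hAs k)
    · rw [hA, hA]; exact blockMat_C_symmetry (hAs k)

theorem matQ_of_toMatrix {m : ℕ} {b : OrthonormalBasis (Idx m) ℂ H} {P : H →L[ℂ] H}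
    {A : Matrix (Fin m ⊕ Fin m) (Fin m ⊕ Fin m) ℂ}
    (h : LinearMap.toMatrix b.toBasis b.toBasis (P : H →ₗ[ℂ] H) = blockMat A) :
    matQ b P = J m * A := by
  rw [matQ, h, blockMat, Matrix.fromBlocks_smul, Matrix.toBlocks_fromBlocks₁₂, smul_smul]
  norm_num

theorem matA_of_toMatrix {m : ℕ} {b : OrthonormalBasis (Idx m) ℂ H} {P : H →L[ℂ] H}
    {A : Matrix (Fin m ⊕ Fin m) (Fin m ⊕ Fin m) ℂ}
    (h : LinearMap.toMatrix b.toBasis b.toBasis (P : H →ₗ[ℂ] H) = blockMat A) :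
    matA b P = A := by
  rw [matA, matQ_of_toMatrix h, ← Matrix.mul_assoc, J_transpose_mul_J, Matrix.one_mul]

theorem matA_mem {m : ℕ} {T C : H ≃ₗᵢ⋆[ℂ] H} {b : OrthonormalBasis (Idx m) ℂ H}
    (hb : IsNormalBasis T C b) {d : ℕ} {P : C(Torus d, H →L[ℂ] H)}
    (hP : P ∈ DIII T C d (2 * m)) :
    (∀ k, matA b (P k) ∈ Matrix.unitaryGroup (Fin m ⊕ Fin m) ℂ) ∧
      (∀ k, matA b (P (-k)) = -(matA b (P k))ᵀ) ∧
      ∀ k, LinearMap.toMatrix b.toBasis b.toBasis (P k : H →ₗ[ℂ] H) =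
        blockMat (matA b (P k)) := by
  obtain ⟨A, hAu, hAs, hA⟩ := (mem_DIII_iff hb P).1 hP
  have h (k) : matA b (P k) = A k := matA_of_toMatrix (hA k)
  exact ⟨fun k => by rw [h]; exact hAu k, fun k => by rw [h, h]; exact hAs k,
    fun k => by rw [h]; exact hA k⟩

/-- The operator with the matrix `½ [1, J A; (J A)^*, 1]`. -/
def ofMatA [FiniteDimensional ℂ H] {m : ℕ} (b : OrthonormalBasis (Idx m) ℂ H)
    (A : Matrix (Fin m ⊕ Fin m) (Fin m ⊕ Fin m) ℂ) : H →L[ℂ] H :=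
  LinearMap.toContinuousLinearMap (Matrix.toLin b.toBasis b.toBasis (blockMat A))

theorem toMatrix_ofMatA [FiniteDimensional ℂ H] {m : ℕ} (b : OrthonormalBasis (Idx m) ℂ H)
    (A : Matrix (Fin m ⊕ Fin m) (Fin m ⊕ Fin m) ℂ) :
    LinearMap.toMatrix b.toBasis b.toBasis (ofMatA b A : H →ₗ[ℂ] H) = blockMat A := by
  simp [ofMatA]

theorem ofMatA_of_toMatrix [FiniteDimensional ℂ H] {m : ℕ} {b : OrthonormalBasis (Idx m) ℂ H}
    {A : Matrix (Fin m ⊕ Fin m) (Fin m ⊕ Fin m) ℂ} {P : H →L[ℂ] H}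
    (h : LinearMap.toMatrix b.toBasis b.toBasis (P : H →ₗ[ℂ] H) = blockMat A) :
    P = ofMatA b A := by
  apply ContinuousLinearMap.coe_injective
  apply (LinearMap.toMatrix b.toBasis b.toBasis).injective
  rw [h, toMatrix_ofMatA]

theorem continuous_ofMatA [FiniteDimensional ℂ H] {m : ℕ} (b : OrthonormalBasis (Idx m) ℂ H) :
    Continuous (ofMatA b) := by
  have h1 : Continuous fun M : Matrix (Idx m) (Idx m) ℂ =>
      LinearMap.toContinuousLinearMap (Matrix.toLin b.toBasis b.toBasis M) :=
    LinearMap.continuous_of_finiteDimensional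
      ((LinearMap.toContinuousLinearMap : (H →ₗ[ℂ] H) ≃ₗ[ℂ] (H →L[ℂ] H)).toLinearMap ∘ₗ
        (Matrix.toLin b.toBasis b.toBasis).toLinearMap)
  have h2 : Continuous fun A : Matrix (Fin m ⊕ Fin m) (Fin m ⊕ Fin m) ℂ => blockMat A := by
    unfold blockMat
    have h3 : Continuous fun A : Matrix (Fin m ⊕ Fin m) (Fin m ⊕ Fin m) ℂ => J m * A := by fun_prop
    exact (continuous_const.matrix_fromBlocks h3 h3.matrix_conjTranspose
      continuous_const).const_smul (1 / 2 : ℂ)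
  exact h1.comp h2

theorem continuous_matA [FiniteDimensional ℂ H] {m : ℕ} (b : OrthonormalBasis (Idx m) ℂ H) :
    Continuous (matA b) := by
  have h1 : Continuous fun P : H →L[ℂ] H =>
      LinearMap.toMatrix b.toBasis b.toBasis (P : H →ₗ[ℂ] H) :=
    LinearMap.continuous_of_finiteDimensional
      ((LinearMap.toMatrix b.toBasis b.toBasis).toLinearMap ∘ₗ
        (LinearMap.toContinuousLinearMap : (H →ₗ[ℂ] H) ≃ₗ[ℂ] (H →L[ℂ] H)).symm.toLinearMap)
  unfold matA matQ
  have h2 : Continuous fun P : H →L[ℂ] H =>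
      (LinearMap.toMatrix b.toBasis b.toBasis (P : H →ₗ[ℂ] H)).toBlocks₁₂ :=
    continuous_matrix fun i j => h1.matrix_elem _ _
  fun_prop

theorem ofMatA_comp_mem [FiniteDimensional ℂ H] {m : ℕ} {T C : H ≃ₗᵢ⋆[ℂ] H}
    {b : OrthonormalBasis (Idx m) ℂ H} (hb : IsNormalBasis T C b) {d : ℕ}
    (A : C(Torus d, U m)) (hA : ∀ k, (A (-k)).1 = -(A k).1ᵀ) :
    (⟨fun k => ofMatA b (A k).1, (continuous_ofMatA b).comp
      (continuous_subtype_val.comp A.continuous)⟩ : C(Torus d, H →L[ℂ] H)) ∈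
        DIII T C d (2 * m) :=
  (mem_DIII_iff hb _).2 ⟨fun k => (A k).1, fun k => (A k).2, hA, fun _ => toMatrix_ofMatA b _⟩

/-- Polarization: `C` preserves norms and exchanges the two terms `x ± iy`. -/
theorem antiunitary_inner (C : H ≃ₗᵢ⋆[ℂ] H) (x y : H) : inner ℂ (C x) (C y) = inner ℂ y x := by
  have h1 : C x - Complex.I • C y = C (x + Complex.I • y) := by
    simp [LinearIsometryEquiv.map_smulₛₗ, sub_eq_add_neg]
  have h2 : C x + Complex.I • C y = C (x - Complex.I • y) := by
    simp [LinearIsometryEquiv.map_smulₛₗ]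
  rw [← inner_conj_symm y x, inner_eq_sum_norm_sq_div_four, inner_eq_sum_norm_sq_div_four]
  simp only [RCLike.I_to_complex]
  rw [h1, h2, ← map_add, ← map_sub]
  rw [LinearIsometryEquiv.norm_map, LinearIsometryEquiv.norm_map, LinearIsometryEquiv.norm_map,
    LinearIsometryEquiv.norm_map]
  simp only [map_div₀, map_add, map_sub, map_mul, map_pow,
    Complex.conj_I, Complex.coe_algebraMap, Complex.conj_ofReal, Complex.conj_ofNat]
  ring

theorem antiunitary_orthonormal {ι : Type*} (C : H ≃ₗᵢ⋆[ℂ] H) {v : ι → H}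
    (hv : Orthonormal ℂ v) : Orthonormal ℂ fun i => C (v i) := by
  classical
  rw [orthonormal_iff_ite] at hv ⊢
  intro i j
  rw [antiunitary_inner, hv]
  simp [eq_comm]

/-- An orthonormal family of the right cardinality is a basis. -/
def orthonormalBasisOfCard [FiniteDimensional ℂ H] {ι : Type*} [Fintype ι] {v : ι → H}
    (hv : Orthonormal ℂ v) (hcard : Fintype.card ι = Module.finrank ℂ H) :
    OrthonormalBasis ι ℂ H :=
  OrthonormalBasis.mk hv (hv.linearIndependent.span_eq_top_of_card_eq_finrank' hcard).ge

theorem coe_orthonormalBasisOfCard [FiniteDimensional ℂ H] {ι : Type*} [Fintype ι] {v : ι → H}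
    (hv : Orthonormal ℂ v) (hcard : Fintype.card ι = Module.finrank ℂ H) (i : ι) :
    orthonormalBasisOfCard hv hcard i = v i := by
  simp [orthonormalBasisOfCard]

/-- The trace of an operator conjugated by an antiunitary operator. -/
theorem trace_antiunitary_conj [FiniteDimensional ℂ H] (C : H ≃ₗᵢ⋆[ℂ] H) (A B : H →ₗ[ℂ] H)
    (h : ∀ x, A (C x) = C (B x)) :
    LinearMap.trace ℂ H B = (starRingEnd ℂ) (LinearMap.trace ℂ H A) := by
  let b := stdOrthonormalBasis ℂ H
  let b' := orthonormalBasisOfCard (antiunitary_orthonormal C b.orthonormal) (by simp)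
  have hb' (i) : b' i = C (b i) := coe_orthonormalBasisOfCard _ _ i
  rw [LinearMap.trace_eq_sum_inner B b, LinearMap.trace_eq_sum_inner A b', map_sum]
  refine Finset.sum_congr rfl fun i _ => ?_
  rw [hb', h, antiunitary_inner, inner_conj_symm]

/-- An operator which a conjugation turns into its complement has half of the full trace. -/
theorem trace_add_conj_trace [FiniteDimensional ℂ H] (C : H ≃ₗᵢ⋆[ℂ] H) (A : H →ₗ[ℂ] H)
    (h : ∀ x, A (C x) = C (x - A x)) :
    LinearMap.trace ℂ H A + (starRingEnd ℂ) (LinearMap.trace ℂ H A) = Module.finrank ℂ H := by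
  have h1 := trace_antiunitary_conj C A (1 - A) h
  rw [map_sub, LinearMap.trace_one] at h1
  rw [← h1]; ring

/-- The dimension of a space with an odd antiunitary operator is even. -/
theorem even_finrank_of_odd (V : Submodule ℂ H) [FiniteDimensional ℂ V] (T : H ≃ₗᵢ⋆[ℂ] H)
    (hT : ∀ x, T (T x) = -x) (hV : ∀ x ∈ V, T x ∈ V) : Even (Module.finrank ℂ V) := by
  let b := stdOrthonormalBasis ℂ V
  set M : Matrix (Fin (Module.finrank ℂ V)) (Fin (Module.finrank ℂ V)) ℂ :=
    fun i j => b.repr ⟨T (b j), hV _ (b j).2⟩ i with hM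
  have h1 (j) : T (b j) = ∑ i, M i j • (b i : H) := by
    have := congrArg (Subtype.val) (b.sum_repr ⟨T (b j), hV _ (b j).2⟩)
    simpa using this.symm
  have h2 : M * M.map star = -1 := by
    ext k j
    have h3 : T (T (b j)) = ∑ k, (M * M.map star) k j • (b k : H) := by
      rw [h1 j, map_sum]
      simp only [LinearIsometryEquiv.map_smulₛₗ, h1, Matrix.mul_apply, Finset.sum_smul,
        Finset.smul_sum, smul_smul, Matrix.map_apply]
      rw [Finset.sum_comm]
      refine Finset.sum_congr rfl fun _ _ => Finset.sum_congr rfl fun _ _ => ?_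
      rw [mul_comm]
      rfl
    have h4 : -(b j) = ∑ k, (M * M.map star) k j • b k := by
      ext1
      rw [hT] at h3
      simpa using h3
    have h5 := congrArg (fun x => b.toBasis.repr x k) h4
    simp only [map_neg, map_sum, map_smul] at h5
    simp at h5
    exact h5.symm.trans (by simp [Matrix.one_apply])
  -- Determinants of `M M̄ = -1` give `|det M|² = (-1)^dim`, which excludes odd dimension.
  have h3 := congrArg Matrix.det h2
  rw [Matrix.det_mul, Matrix.det_neg, Matrix.det_one, mul_one, Fintype.card_fin] at h3
  have h4 : (M.map star).det = star M.det := by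
    have := (starRingEnd ℂ).map_det M
    exact this.symm
  rw [h4, RCLike.star_def, Complex.mul_conj'] at h3
  by_contra hodd
  rw [Nat.not_even_iff_odd] at hodd
  rw [hodd.neg_one_pow] at h3
  have h5 : ‖M.det‖ ^ 2 = -1 := by exact_mod_cast h3
  nlinarith [sq_nonneg ‖M.det‖]

/-- Only the fixed point `k = 0` of `k ↦ -k` is used: there `C` gives `N = 2n`, and `T` preserves
the range of `P(0)`. -/
theorem exists_dim_of_mem_DIII [FiniteDimensional ℂ H] {T C : H ≃ₗᵢ⋆[ℂ] H}
    (hTC : IsDIIIPair T C) {d n : ℕ} (h : (DIII T C d n).Nonempty) :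
    ∃ m : ℕ, n = 2 * m ∧ Module.finrank ℂ H = 4 * m := by
  obtain ⟨P, hG, hT, hC⟩ := h
  obtain ⟨hPP, -, htr⟩ := hG 0
  have hT0 (x) : P 0 (T x) = T (P 0 x) := by
    have := hT 0 x
    rw [neg_zero, LinearIsometryEquiv.symm_apply_eq] at this
    exact this
  have hC0 (x) : P 0 (C x) = C (x - P 0 x) := by
    have := hC 0 x
    rw [neg_zero, LinearIsometryEquiv.symm_apply_eq] at this
    exact this
  have hN := trace_add_conj_trace C (P 0 : H →ₗ[ℂ] H) hC0
  rw [htr, Complex.conj_natCast] at hN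
  have hN' : Module.finrank ℂ H = n + n := by exact_mod_cast hN.symm
  have hid : IsIdempotentElem (P 0 : H →ₗ[ℂ] H) := by
    ext x; exact congrArg (fun f : H →L[ℂ] H => f x) hPP
  have hr : Module.finrank ℂ (LinearMap.range (P 0 : H →ₗ[ℂ] H)) = n := by
    have := (LinearMap.IsIdempotentElem.isProj_range _ hid).trace
    rw [htr] at this
    exact_mod_cast this.symm
  have he : Even n := by
    rw [← hr]
    refine even_finrank_of_odd _ T hTC.T_odd ?_
    rintro _ ⟨x, rfl⟩
    exact ⟨T x, hT0 x⟩
  obtain ⟨m, rfl⟩ := he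
  exact ⟨m, by ring, by omega⟩

end NormalForm

/-! ### Existence of normal bases and DIII pairs; change of normal basis -/

section NormalForm

variable {H : Type*} [NormedAddCommGroup H] [InnerProductSpace ℂ H]

/-- The chiral symmetry `T C`. -/
def chiral (T C : H ≃ₗᵢ⋆[ℂ] H) : H →ₗ[ℂ] H where
  toFun x := T (C x)
  map_add' x y := by simp
  map_smul' a x := by simp [LinearIsometryEquiv.map_smulₛₗ]

theorem chiral_apply (T C : H ≃ₗᵢ⋆[ℂ] H) (x : H) : chiral T C x = T (C x) := rfl

theorem IsDIIIPair.C_T_C {T C : H ≃ₗᵢ⋆[ℂ] H} (h : IsDIIIPair T C) (x : H) :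
    C (T (C x)) = -T x := by
  have h1 := congrArg T (h.TC_sq x)
  rw [h.T_odd] at h1
  rw [← h1, neg_neg]

theorem IsDIIIPair.C_T {T C : H ≃ₗᵢ⋆[ℂ] H} (h : IsDIIIPair T C) (x : H) :
    C (T x) = -T (C x) := by
  rw [← h.C_T_C, h.C_even]

/-- `E` is the +1 eigenspace of `TC`. Conjugation by `C` exchanges its projection with the
complementary one, so it has half of the dimension. -/
theorem finrank_chiral [FiniteDimensional ℂ H] {T C : H ≃ₗᵢ⋆[ℂ] H} (h : IsDIIIPair T C)
    {m : ℕ} (hm : Module.finrank ℂ H = 4 * m) :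
    ∃ E : Submodule ℂ H, Module.finrank ℂ E = 2 * m ∧ ∀ x ∈ E, T (C x) = x := by
  set p : H →ₗ[ℂ] H := (1 / 2 : ℂ) • (1 + chiral T C) with hp
  have hpx (x) : p x = (1 / 2 : ℂ) • (x + T (C x)) := rfl
  have hhalf (x : H) : (1 / 2 : ℂ) • x + (1 / 2 : ℂ) • x = x := by
    rw [← add_smul]; norm_num
  have hTCp (x) : T (C (p x)) = p x := by
    rw [hpx, ← chiral_apply, map_smul, map_add, chiral_apply, chiral_apply, h.TC_sq, add_comm]
  have hid : IsIdempotentElem p := by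
    ext x
    change p (p x) = p x
    rw [hpx (p x), hTCp, smul_add, hhalf]
  have hpC (x) : p (C x) = C (x - p x) := by
    have hC2 (y : H) : C ((1 / 2 : ℂ) • y) = (1 / 2 : ℂ) • C y := by
      have h2 : (starRingEnd ℂ) 2 = 2 := Complex.conj_ofNat 2
      rw [LinearIsometryEquiv.map_smulₛₗ]; simp [h2]
    rw [hpx, hpx, h.C_even, map_sub, hC2, map_add, h.C_T_C]
    nth_rw 3 [← hhalf (C x)]
    module
  have htr := (LinearMap.IsIdempotentElem.isProj_range _ hid).trace
  have h2 := trace_add_conj_trace C p hpC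
  rw [htr, Complex.conj_natCast, hm] at h2
  have h3 : Module.finrank ℂ (LinearMap.range p) + Module.finrank ℂ (LinearMap.range p) = 4 * m := by
    exact_mod_cast h2
  refine ⟨LinearMap.range p, by omega, ?_⟩
  rintro _ ⟨x, rfl⟩
  exact hTCp x

theorem exists_isNormalBasis [FiniteDimensional ℂ H] {T C : H ≃ₗᵢ⋆[ℂ] H} (h : IsDIIIPair T C)
    {m : ℕ} (hm : Module.finrank ℂ H = 4 * m) :
    ∃ b : OrthonormalBasis (Idx m) ℂ H, IsNormalBasis T C b := by
  obtain ⟨E, hE, hES⟩ := finrank_chiral h hm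
  let e := (stdOrthonormalBasis ℂ E).reindex
    (Fintype.equivOfCardEq (by simp [hE]; ring) : Fin (Module.finrank ℂ E) ≃ Fin m ⊕ Fin m)
  have heC (x : E) : C (x : H) = -T x := by
    have h1 := congrArg T (hES x x.2)
    rw [h.T_odd] at h1
    rw [← h1, neg_neg]
  have he : Orthonormal ℂ fun i => (e i : H) :=
    e.orthonormal.comp_linearIsometry E.subtypeₗᵢ
  have heo := orthonormal_iff_ite.1 he
  -- The unitary `TC` fixes `x` and negates `T y`, as `C` and `T` anticommute.
  have horth (x y : E) : inner ℂ (x : H) (T y) = 0 := by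
    have h1 : inner ℂ (T (C (x : H))) (T (C (T y))) = inner ℂ (x : H) (T y) := by
      rw [antiunitary_inner, antiunitary_inner]
    rw [hES x x.2, h.C_T, hES y y.2, map_neg, inner_neg_right] at h1
    have h2 : inner ℂ (x : H) (T y) + inner ℂ (x : H) (T y) = 0 := by
      nth_rw 1 [← h1]; ring
    simpa using h2
  have horth' (x y : E) : inner ℂ (T x) (y : H) = 0 := by
    rw [← inner_conj_symm, horth, map_zero]
  -- An orthonormal basis of `E` and its image under `T`; the order and the signs of the second half
  -- are read off from the columns of `J`.
  let v : Idx m → H := Sum.elim (fun i => (e i : H))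
    (Sum.elim (fun i => T (e (Sum.inr i))) (fun i => -T (e (Sum.inl i))))
  have hv : Orthonormal ℂ v := by
    rw [orthonormal_iff_ite]
    rintro (i | i | i) (j | j | j) <;>
      simp [v, heo, horth, horth', antiunitary_inner, -Submodule.coe_inner, eq_comm]
  let b := orthonormalBasisOfCard hv (by simp [hm]; ring)
  have hb (i) : b i = v i := coe_orthonormalBasisOfCard hv _ i
  refine ⟨b, ⟨?_, ?_⟩⟩
  · rintro ((j | j) | (j | j)) <;>
      simp [hb, v, Fintype.sum_sum_type, J, Matrix.one_apply, ite_smul, h.T_odd, neg_ite]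
  · rintro ((j | j) | (j | j)) <;>
      simp [hb, v, Fintype.sum_sum_type, J, Matrix.one_apply, ite_smul, h.C_T, heC, h.T_odd, neg_ite]

/-- The antiunitary operator which maps one orthonormal basis to another. -/
def antiunitaryOfBases {ι : Type*} [Fintype ι] (b b' : OrthonormalBasis ι ℂ H) :
    H ≃ₗᵢ⋆[ℂ] H where
  toFun x := b'.repr.symm (WithLp.toLp 2 fun i => (starRingEnd ℂ) (b.repr x i))
  invFun x := b.repr.symm (WithLp.toLp 2 fun i => (starRingEnd ℂ) (b'.repr x i))
  map_add' x y := by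
    rw [← map_add]; congr 1; ext i; simp
  map_smul' a x := by
    rw [← map_smul]; congr 1; ext i; simp
  left_inv x := by simp
  right_inv x := by simp
  norm_map' x := by
    change ‖b'.repr.symm (WithLp.toLp 2 fun i => (starRingEnd ℂ) (b.repr x i))‖ = ‖x‖
    rw [LinearIsometryEquiv.norm_map, ← b.repr.norm_map x, EuclideanSpace.norm_eq,
      EuclideanSpace.norm_eq]
    simp

theorem antiunitaryOfBases_apply {ι : Type*} [Fintype ι] (b b' : OrthonormalBasis ι ℂ H) (i : ι) :
    antiunitaryOfBases b b' (b i) = b' i := by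
  classical
  change b'.repr.symm (WithLp.toLp 2 fun j => (starRingEnd ℂ) (b.repr (b i) j)) = b' i
  rw [LinearIsometryEquiv.symm_apply_eq, OrthonormalBasis.repr_self, OrthonormalBasis.repr_self]
  ext j
  simp [apply_ite]

theorem linearMap_eq_of_basis {ι : Type*} [Fintype ι] (b : OrthonormalBasis ι ℂ H)
    (f g : H →ₗ[ℂ] H) (h : ∀ i, f (b i) = g (b i)) (x : H) : f x = g x := by
  rw [b.toBasis.ext (f₁ := f) (f₂ := g) (by simpa using h)]

theorem exists_isDIIIPair [FiniteDimensional ℂ H] {m : ℕ} (hm : Module.finrank ℂ H = 4 * m) :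
    ∃ T C : H ≃ₗᵢ⋆[ℂ] H, IsDIIIPair T C := by
  let b : OrthonormalBasis (Idx m) ℂ H := (stdOrthonormalBasis ℂ H).reindex
    (Fintype.equivOfCardEq (by simp [hm]; ring))
  have hbo := orthonormal_iff_ite.1 b.orthonormal
  let v : Idx m → H := Sum.elim
    (Sum.elim (fun i => -b (Sum.inr (Sum.inr i))) (fun i => b (Sum.inr (Sum.inl i))))
    (Sum.elim (fun i => -b (Sum.inl (Sum.inr i))) (fun i => b (Sum.inl (Sum.inl i))))
  let u : Idx m → H := Sum.elim
    (Sum.elim (fun i => b (Sum.inr (Sum.inr i))) (fun i => -b (Sum.inr (Sum.inl i))))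
    (Sum.elim (fun i => -b (Sum.inl (Sum.inr i))) (fun i => b (Sum.inl (Sum.inl i))))
  have hv : Orthonormal ℂ v := by
    rw [orthonormal_iff_ite]
    rintro ((i | i) | (i | i)) ((j | j) | (j | j)) <;> simp [v, hbo]
  have hu : Orthonormal ℂ u := by
    rw [orthonormal_iff_ite]
    rintro ((i | i) | (i | i)) ((j | j) | (j | j)) <;> simp [u, hbo]
  have hcard : Fintype.card (Idx m) = Module.finrank ℂ H := by simp [hm]; ring
  let T := antiunitaryOfBases b (orthonormalBasisOfCard hv hcard)
  let C := antiunitaryOfBases b (orthonormalBasisOfCard hu hcard)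
  have hT (i) : T (b i) = v i := by
    rw [antiunitaryOfBases_apply, coe_orthonormalBasisOfCard]
  have hC (i) : C (b i) = u i := by
    rw [antiunitaryOfBases_apply, coe_orthonormalBasisOfCard]
  have hTC : ∀ x, T (C (T (C x))) = x := by
    refine fun x => linearMap_eq_of_basis b (chiral T C * chiral T C) 1 ?_ x
    rintro ((i | i) | (i | i)) <;> simp [chiral_apply, hT, hC, u, v]
  refine ⟨T, C, ⟨fun x => ?_, fun x => ?_, hTC⟩⟩
  · refine linearMap_eq_of_basis b (chiral T T) (-1) ?_ x
    rintro ((i | i) | (i | i)) <;> simp [chiral_apply, hT, v]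
  · refine linearMap_eq_of_basis b (chiral C C) 1 ?_ x
    rintro ((i | i) | (i | i)) <;> simp [chiral_apply, hC, u]

/-- Unitary matrices which commute with both symmetries act on the matrices `A` by congruence. -/
theorem exists_blockMat_congr {m : ℕ} {M : Matrix (Idx m) (Idx m) ℂ} (hM : Mᴴ * M = 1)
    (hT : M * Matrix.fromBlocks 0 (J m) (J m) 0 = Matrix.fromBlocks 0 (J m) (J m) 0 * M.map star)
    (hC : M * Matrix.fromBlocks 0 (J m) (-J m) 0 =
      Matrix.fromBlocks 0 (J m) (-J m) 0 * M.map star) :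
    ∃ W : U m, ∀ A : Matrix (Fin m ⊕ Fin m) (Fin m ⊕ Fin m) ℂ,
      Mᴴ * blockMat A * M = blockMat (W.1ᵀ * A * W.1) := by
  obtain ⟨a, b, c, d, rfl⟩ : ∃ a b c d, M = Matrix.fromBlocks a b c d :=
    ⟨_, _, _, _, (Matrix.fromBlocks_toBlocks M).symm⟩
  rw [Matrix.fromBlocks_map, Matrix.fromBlocks_multiply, Matrix.fromBlocks_multiply,
    Matrix.fromBlocks_inj] at hT hC
  simp only [Matrix.mul_zero, Matrix.zero_mul, zero_add, add_zero, Matrix.mul_neg,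
    Matrix.neg_mul] at hT hC
  have zero {X : Matrix (Fin m ⊕ Fin m) (Fin m ⊕ Fin m) ℂ} (h : X * J m = -(X * J m)) : X = 0 :=
    mul_J_cancel (by
      rw [Matrix.zero_mul]; ext i j; exact self_eq_neg.1 (congrFun (congrFun h i) j))
  -- Commuting with `T` and `C` means commuting with `TC = diag(1, -1)`, so `M` is block diagonal;
  -- the block `a` is then determined by `d`.
  have hb : b = 0 := zero (hT.1.trans hC.1.symm)
  have hc : c = 0 := zero (hC.2.2.2.trans (by rw [hT.2.2.2]))
  subst hb hc
  have had : aᴴ * J m = J m * dᵀ := by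
    have h1 := congrArg Matrix.conjTranspose hT.2.1
    rw [Matrix.conjTranspose_mul, Matrix.conjTranspose_mul, J_conjTranspose, Matrix.neg_mul,
      Matrix.mul_neg, neg_inj] at h1
    have h2 : (d.map star)ᴴ = dᵀ := by ext i j; simp
    rw [h2] at h1
    apply J_mul_cancel
    rw [← Matrix.mul_assoc, h1, Matrix.mul_assoc, ← Matrix.mul_assoc (J m), J_mul_J]
    simp
  rw [Matrix.fromBlocks_conjTranspose, Matrix.fromBlocks_multiply, ← Matrix.fromBlocks_one,
    Matrix.fromBlocks_inj] at hM
  simp only [Matrix.conjTranspose_zero, Matrix.mul_zero, Matrix.zero_mul, zero_add,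
    add_zero] at hM
  refine ⟨⟨d, Matrix.mem_unitaryGroup_iff'.2 hM.2.2.2⟩, fun A => ?_⟩
  have hQ : aᴴ * (J m * A) * d = J m * (dᵀ * A * d) := by
    rw [← Matrix.mul_assoc, had]; simp only [Matrix.mul_assoc]
  rw [blockMat, blockMat, Matrix.fromBlocks_conjTranspose, Matrix.mul_smul, Matrix.smul_mul,
    Matrix.fromBlocks_multiply, Matrix.fromBlocks_multiply, ← hQ]
  simp only [Matrix.conjTranspose_zero, Matrix.mul_zero, Matrix.zero_mul, zero_add,
    add_zero, Matrix.mul_one, hM.1, hM.2.2.2]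
  simp only [Matrix.conjTranspose_mul, Matrix.conjTranspose_conjTranspose, Matrix.mul_assoc]

/-- Two bases of normal form lead to congruent matrices `A`. -/
theorem exists_matA_eq [FiniteDimensional ℂ H] {T C : H ≃ₗᵢ⋆[ℂ] H} {m : ℕ}
    {b b' : OrthonormalBasis (Idx m) ℂ H} (hb : IsNormalBasis T C b) (hb' : IsNormalBasis T C b') :
    ∃ W : U m, ∀ (P : H →L[ℂ] H) (A : Matrix (Fin m ⊕ Fin m) (Fin m ⊕ Fin m) ℂ),
      LinearMap.toMatrix b.toBasis b.toBasis (P : H →ₗ[ℂ] H) = blockMat A →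
      matA b' P = W.1ᵀ * A * W.1 := by
  set R : H ≃ₗᵢ[ℂ] H := b.equiv b' (Equiv.refl _) with hR
  have hRb (i) : R (b i) = b' i := by simp [hR]
  set M := LinearMap.toMatrix b.toBasis b.toBasis (R.toLinearEquiv : H →ₗ[ℂ] H) with hM
  have hMs : LinearMap.toMatrix b.toBasis b.toBasis (R.symm.toLinearEquiv : H →ₗ[ℂ] H) = Mᴴ := by
    ext i j
    simp only [hM, Matrix.conjTranspose_apply, LinearMap.toMatrix_apply]
    simp only [LinearEquiv.coe_coe, OrthonormalBasis.coe_toBasis, OrthonormalBasis.coe_toBasis_repr_apply,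
      OrthonormalBasis.repr_apply_apply, LinearIsometryEquiv.coe_toLinearEquiv]
    rw [RCLike.star_def, inner_conj_symm, ← R.inner_map_map, R.apply_symm_apply]
  have hM1 : Mᴴ * M = 1 := by
    rw [← hMs, hM, ← LinearMap.toMatrix_comp, ← LinearMap.toMatrix_id b.toBasis]
    congr 1
    ext x; simp
  have hconj (P : H →ₗ[ℂ] H) : LinearMap.toMatrix b'.toBasis b'.toBasis P =
      Mᴴ * LinearMap.toMatrix b.toBasis b.toBasis P * M := by
    rw [← hMs, hM, ← LinearMap.toMatrix_comp _ b.toBasis, ← LinearMap.toMatrix_comp _ b.toBasis]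
    ext i j
    simp only [LinearMap.toMatrix_apply]
    simp only [LinearEquiv.coe_coe, OrthonormalBasis.coe_toBasis, LinearMap.comp_apply,
      OrthonormalBasis.coe_toBasis_repr_apply, OrthonormalBasis.repr_apply_apply,
      LinearIsometryEquiv.coe_toLinearEquiv, ← hRb]
    rw [← R.inner_map_map (b i), R.apply_symm_apply]
  have hcomm {S : H ≃ₗᵢ⋆[ℂ] H} {N : Matrix (Idx m) (Idx m) ℂ} (h : HasAntilinearMatrix b S N)
      (h' : HasAntilinearMatrix b' S N) : M * N = N * M.map star := by
    refine (antilinear_comm_iff h _ _).1 fun x => ?_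
    have h1 : (R.toLinearEquiv : H →ₗ[ℂ] H).comp (S.toLinearEquiv : H →ₛₗ[starRingEnd ℂ] H) =
        (S.toLinearEquiv : H →ₛₗ[starRingEnd ℂ] H).comp (R.toLinearEquiv : H →ₗ[ℂ] H) := by
      refine b.toBasis.ext fun j => ?_
      have h2 : R (S (b j)) = S (R (b j)) := by
        rw [h j, hRb, h' j, map_sum]
        simp [hRb]
      simpa using h2
    exact congrArg (fun f : H →ₛₗ[starRingEnd ℂ] H => f x) h1
  obtain ⟨W, hW⟩ := exists_blockMat_congr hM1 (hcomm hb.T_form hb'.T_form)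
    (hcomm hb.C_form hb'.C_form)
  refine ⟨W, fun P A hA => matA_of_toMatrix ?_⟩
  rw [hconj, hA, hW]

end NormalForm

/-! ### The homeomorphisms and the classification for `d = 0` and `d = 1` -/

section Classification

variable {H : Type*} [NormedAddCommGroup H] [InnerProductSpace ℂ H] {m : ℕ}

/-- The families of unitary matrices with `A(-k) = -A(k)ᵀ`. -/
def symFam (d m : ℕ) : Set C(Torus d, U m) :=
  {A | ∀ k, (A (-k)).1 = -(A k).1ᵀ}

/-- The families of projections correspond to the families of matrices `A`. -/
def homeoSymFam [FiniteDimensional ℂ H] {T C : H ≃ₗᵢ⋆[ℂ] H} {b : OrthonormalBasis (Idx m) ℂ H}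
    (hb : IsNormalBasis T C b) (d : ℕ) : DIII T C d (2 * m) ≃ₜ symFam d m where
  toFun P := ⟨⟨fun k => ⟨matA b (P.1 k), (matA_mem hb P.2).1 k⟩,
    Continuous.subtype_mk ((continuous_matA b).comp P.1.continuous) _⟩, (matA_mem hb P.2).2.1⟩
  invFun A := ⟨⟨fun k => ofMatA b (A.1 k).1, (continuous_ofMatA b).comp
    (continuous_subtype_val.comp A.1.continuous)⟩, ofMatA_comp_mem hb A.1 A.2⟩
  left_inv P := by
    ext1; ext1 k
    exact (ofMatA_of_toMatrix ((matA_mem hb P.2).2.2 k)).symm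
  right_inv A := by
    ext1; ext1 k
    exact Subtype.ext (matA_of_toMatrix (toMatrix_ofMatA b _))
  continuous_toFun := by
    refine Continuous.subtype_mk (ContinuousMap.continuous_of_continuous_uncurry _ ?_) _
    refine Continuous.subtype_mk ((continuous_matA b).comp ?_) _
    exact (continuous_subtype_val.comp continuous_fst).eval continuous_snd
  continuous_invFun := by
    refine Continuous.subtype_mk (ContinuousMap.continuous_of_continuous_uncurry _ ?_) _
    refine (continuous_ofMatA b).comp (continuous_subtype_val.comp ?_)
    exact (continuous_subtype_val.comp continuous_fst).eval continuous_snd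

theorem matA_homeoSymFam_symm [FiniteDimensional ℂ H] {T C : H ≃ₗᵢ⋆[ℂ] H}
    {b : OrthonormalBasis (Idx m) ℂ H} (hb : IsNormalBasis T C b) {d : ℕ} (A : symFam d m)
    (k : Torus d) : matA b (((homeoSymFam hb d).symm A).1 k) = (A.1 k).1 :=
  matA_of_toMatrix (toMatrix_ofMatA b _)

/-- Congruent to `J`, as a constant family. -/
def congrJ (d : ℕ) (V : U m) : symFam d m :=
  ⟨ContinuousMap.const _ (Matrix.UnitaryGroup.transpose V * ⟨J m, J_mem_unitary m⟩ * V), fun k => by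
    change V.1ᵀ * J m * V.1 = -(V.1ᵀ * J m * V.1)ᵀ
    rw [Matrix.transpose_mul, Matrix.transpose_mul, J_transpose]
    simp [Matrix.mul_assoc]⟩

theorem congrJ_apply (d : ℕ) (V : U m) (k : Torus d) :
    ((congrJ d V).1 k).1 = V.1ᵀ * J m * V.1 := rfl

theorem continuous_congrJ (d : ℕ) : Continuous (congrJ d : U m → symFam d m) :=
  Continuous.subtype_mk (ContinuousMap.continuous_const'.comp
    ((continuous_transposeU.mul continuous_const).mul continuous_id)) _

theorem congrJ_surjective : Function.Surjective (congrJ 0 : U m → symFam 0 m) := by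
  intro A
  have hA : (A.1 0).1ᵀ = -(A.1 0).1 := by
    have := A.2 0
    rw [neg_zero] at this
    nth_rw 2 [this]
    rw [neg_neg]
  obtain ⟨V, hV⟩ := exists_eq_transpose_mul_J_mul (A.1 0).2 hA
  refine ⟨V, ?_⟩
  ext1; ext1 k
  refine Subtype.ext ?_
  rw [congrJ_apply, hV, Subsingleton.elim k 0]

theorem isPathConnected_DIII_zero [FiniteDimensional ℂ H] {T C : H ≃ₗᵢ⋆[ℂ] H}
    {b : OrthonormalBasis (Idx m) ℂ H} (hb : IsNormalBasis T C b) :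
    IsPathConnected (DIII T C 0 (2 * m)) := by
  rw [isPathConnected_iff_pathConnectedSpace]
  have : PathConnectedSpace (U m) := ⟨⟨1⟩, joined_unitaryGroup⟩
  exact ((homeoSymFam hb 0).symm.surjective.comp congrJ_surjective).pathConnectedSpace
    ((homeoSymFam hb 0).symm.continuous.comp (continuous_congrJ 0))

/-- `V ↦ VᵀJV` is constant on the right cosets `Sp(m)V`; the inverse turns them into left cosets. -/
theorem congrJ_inv_eq_iff (V W : U m) :
    congrJ 0 V⁻¹ = congrJ 0 W⁻¹ ↔ V⁻¹ * W ∈ Sp m := by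
  have h1 : congrJ 0 V⁻¹ = congrJ 0 W⁻¹ ↔
      V⁻¹.1ᵀ * J m * V⁻¹.1 = W⁻¹.1ᵀ * J m * W⁻¹.1 := by
    constructor
    · intro h
      exact congrArg (fun A : symFam 0 m => (A.1 0).1) h
    · intro h
      ext1; ext1 k
      exact Subtype.ext h
  have h2 : V⁻¹ * W ∈ Sp m ↔ (V⁻¹ * W).1ᵀ * J m * (V⁻¹ * W).1 = J m := Iff.rfl
  rw [h1, h2, Submonoid.coe_mul, Matrix.transpose_mul]
  have e1 : W⁻¹.1 * W.1 = 1 := by rw [← Submonoid.coe_mul, inv_mul_cancel, Submonoid.coe_one]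
  have e2 : W.1 * W⁻¹.1 = 1 := by rw [← Submonoid.coe_mul, mul_inv_cancel, Submonoid.coe_one]
  have e3 : W.1ᵀ * W⁻¹.1ᵀ = 1 := by rw [← Matrix.transpose_mul, e1, Matrix.transpose_one]
  have e4 : W⁻¹.1ᵀ * W.1ᵀ = 1 := by rw [← Matrix.transpose_mul, e2, Matrix.transpose_one]
  constructor
  · intro h
    calc _ = W.1ᵀ * (V⁻¹.1ᵀ * J m * V⁻¹.1) * W.1 := by simp only [Matrix.mul_assoc]
      _ = (W.1ᵀ * W⁻¹.1ᵀ) * J m * (W⁻¹.1 * W.1) := by rw [h]; simp only [Matrix.mul_assoc]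
      _ = J m := by rw [e1, e3, Matrix.one_mul, Matrix.mul_one]
  · intro h
    calc _ = (W⁻¹.1ᵀ * W.1ᵀ) * (V⁻¹.1ᵀ * J m * V⁻¹.1) * (W.1 * W⁻¹.1) := by
          rw [e2, e4, Matrix.one_mul, Matrix.mul_one]
      _ = W⁻¹.1ᵀ * (W.1ᵀ * V⁻¹.1ᵀ * J m * (V⁻¹.1 * W.1)) * W⁻¹.1 := by
          simp only [Matrix.mul_assoc]
      _ = _ := by rw [h]

/-- The left cosets of `Sp(m)` correspond to the antisymmetric unitary matrices. -/
def homeoQuotient (m : ℕ) : (U m ⧸ Sp m) ≃ₜ symFam 0 m := by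
  let f : U m ⧸ Sp m → symFam 0 m := Quotient.lift (fun V : U m => congrJ 0 V⁻¹) fun V W h =>
    (congrJ_inv_eq_iff V W).2 (QuotientGroup.leftRel_apply.1 h)
  have hf : Continuous f := ((continuous_congrJ 0).comp continuous_inv).quotient_lift _
  have hb : Function.Bijective f := by
    constructor
    · rintro ⟨V⟩ ⟨W⟩ h
      exact Quotient.sound (QuotientGroup.leftRel_apply.2 ((congrJ_inv_eq_iff V W).1 h))
    · intro A
      obtain ⟨V, hV⟩ := congrJ_surjective A
      exact ⟨QuotientGroup.mk V⁻¹, by simpa [f] using hV⟩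
  -- A continuous bijection from a compact space to a Hausdorff space.
  exact Continuous.homeoOfEquivCompactToT2 (f := Equiv.ofBijective f hb) hf

/-- The symmetric loops as families over the one-dimensional torus. -/
def homeoSymLoop (m : ℕ) : symFam 1 m ≃ₜ symLoop m where
  toFun A := ⟨A.1.comp ⟨fun k _ => k, by fun_prop⟩, fun k => A.2 fun _ => k⟩
  invFun A := ⟨A.1.comp ⟨fun k => k 0, by fun_prop⟩, fun k => A.2 (k 0)⟩
  left_inv A := by
    ext1; ext1 k
    change A.1 (fun _ => k 0) = A.1 k
    congr 1; ext i; rw [Subsingleton.elim i 0]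
  right_inv A := rfl
  continuous_toFun := Continuous.subtype_mk
    ((ContinuousMap.continuous_precomp _).comp continuous_subtype_val) _
  continuous_invFun := Continuous.subtype_mk
    ((ContinuousMap.continuous_precomp _).comp continuous_subtype_val) _

/-- The loop of the matrices `A(k)`. -/
def loopOf [FiniteDimensional ℂ H] {T C : H ≃ₗᵢ⋆[ℂ] H} {b : OrthonormalBasis (Idx m) ℂ H}
    (hb : IsNormalBasis T C b) : DIII T C 1 (2 * m) ≃ₜ symLoop m :=
  (homeoSymFam hb 1).trans (homeoSymLoop m)

theorem loopOf_apply [FiniteDimensional ℂ H] {T C : H ≃ₗᵢ⋆[ℂ] H}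
    {b : OrthonormalBasis (Idx m) ℂ H} (hb : IsNormalBasis T C b) (P : DIII T C 1 (2 * m))
    (k : UnitAddCircle) : ((loopOf hb P).1 k).1 = matA b (P.1 fun _ => k) := rfl

theorem isPhase_iff [FiniteDimensional ℂ H] {T C : H ≃ₗᵢ⋆[ℂ] H}
    {b : OrthonormalBasis (Idx m) ℂ H} (hb : IsNormalBasis T C b) (P : DIII T C 1 (2 * m))
    (α : ℝ → ℝ) : IsPhase b P.1 α ↔ IsLoopPhase (loopOf hb P).1 α := by
  refine and_congr_right' (forall₂_congr fun k _ => ?_)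
  rw [← Circle.coe_inj, Circle.coe_exp, mul_comm Complex.I]
  rfl

theorem indexFormula_eq [FiniteDimensional ℂ H] {T C : H ≃ₗᵢ⋆[ℂ] H}
    {b : OrthonormalBasis (Idx m) ℂ H} (hb : IsNormalBasis T C b) (P : DIII T C 1 (2 * m))
    (α : ℝ → ℝ) : indexFormula b P.1 α = loopIndex (loopOf hb P).1 α := rfl

theorem joinedIn_DIII_one_iff [FiniteDimensional ℂ H] {T C : H ≃ₗᵢ⋆[ℂ] H}
    {b : OrthonormalBasis (Idx m) ℂ H} (hb : IsNormalBasis T C b) (P₀ P₁ : DIII T C 1 (2 * m)) :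
    JoinedIn (DIII T C 1 (2 * m)) P₀.1 P₁.1 ↔
      JoinedIn (symLoop m) (loopOf hb P₀).1 (loopOf hb P₁).1 := by
  rw [joinedIn_iff_joined P₀.2 P₁.2, joinedIn_iff_joined (loopOf hb P₀).2 (loopOf hb P₁).2]
  refine ⟨fun h => h.map (loopOf hb).continuous, fun h => ?_⟩
  simpa using h.map (loopOf hb).symm.continuous

/-- The change of basis is a constant congruence, and `U(2m)` is connected. This makes the index
independent of the normal basis. -/
theorem joinedIn_loopOf [FiniteDimensional ℂ H] {T C : H ≃ₗᵢ⋆[ℂ] H}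
    {b b' : OrthonormalBasis (Idx m) ℂ H} (hb : IsNormalBasis T C b) (hb' : IsNormalBasis T C b')
    (P : DIII T C 1 (2 * m)) : JoinedIn (symLoop m) (loopOf hb P).1 (loopOf hb' P).1 := by
  obtain ⟨W, hW⟩ := exists_matA_eq hb hb'
  have h : (loopOf hb' P).1 = gauge (ContinuousMap.const _ W) (loopOf hb P).1 := by
    ext1 k
    refine Subtype.ext ?_
    rw [gauge_apply, loopOf_apply, loopOf_apply]
    exact hW _ _ ((matA_mem hb P.2).2.2 _)
  rw [h]
  exact joinedIn_gauge_one (loopOf hb P).2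
    ((joined_unitaryGroup 1 W).map ContinuousMap.continuous_const')

theorem exists_index [FiniteDimensional ℂ H] {T C : H ≃ₗᵢ⋆[ℂ] H}
    {b : OrthonormalBasis (Idx m) ℂ H} (hb : IsNormalBasis T C b) :
    ∃ Index : DIII T C 1 (2 * m) → ℤˣ,
      (∀ b : OrthonormalBasis (Idx m) ℂ H, IsNormalBasis T C b →
        ∀ P : DIII T C 1 (2 * m), (∃ α : ℝ → ℝ, IsPhase b P.1 α) ∧
          ∀ α : ℝ → ℝ, IsPhase b P.1 α →
            (((Index P : ℤˣ) : ℤ) : ℂ) = indexFormula b P.1 α) ∧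
      ∀ P₀ P₁ : DIII T C 1 (2 * m),
        JoinedIn (DIII T C 1 (2 * m)) P₀.1 P₁.1 ↔ Index P₀ = Index P₁ := by
  -- The index is defined with the one basis `b` and a chosen phase; invariance of `loopIndex` along
  -- homotopies transfers it to all others.
  choose α hα using fun P : DIII T C 1 (2 * m) => exists_isLoopPhase (loopOf hb P).1
  have hsign (P : DIII T C 1 (2 * m)) :
      ∃ u : ℤˣ, ((u : ℤ) : ℂ) = loopIndex (loopOf hb P).1 (α P) := by
    rcases mul_self_eq_one_iff.1 ((sq _).symm.trans (loopIndex_sq (loopOf hb P).2 (hα P))) with h | h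
    · exact ⟨1, by simp [h]⟩
    · exact ⟨-1, by simp [h]⟩
  choose u hu using hsign
  refine ⟨u, fun b' hb' P => ⟨?_, fun β hβ => ?_⟩, fun P₀ P₁ => ?_⟩
  · obtain ⟨β, hβ⟩ := exists_isLoopPhase (loopOf hb' P).1
    exact ⟨β, (isPhase_iff hb' P β).2 hβ⟩
  · rw [hu, indexFormula_eq hb' P]
    exact loopIndex_eq_of_joinedIn (joinedIn_loopOf hb hb' P) (hα P) ((isPhase_iff hb' P β).1 hβ)
  · rw [joinedIn_DIII_one_iff hb,
      joinedIn_symLoop_iff (loopOf hb P₀).2 (loopOf hb P₁).2 (hα P₀) (hα P₁), ← hu, ← hu]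
    norm_cast

theorem nonempty_DIII [FiniteDimensional ℂ H] {T C : H ≃ₗᵢ⋆[ℂ] H} (h : IsDIIIPair T C)
    (hm : Module.finrank ℂ H = 4 * m) (d : ℕ) : (DIII T C d (2 * m)).Nonempty := by
  obtain ⟨b, hb⟩ := exists_isNormalBasis h hm
  exact ⟨_, ((homeoSymFam hb d).symm (congrJ d 1)).2⟩

end Classification

end ClassDIII

end

theorem mainTheorem1 {H : Type*} [NormedAddCommGroup H] [InnerProductSpace ℂ H]
    [FiniteDimensional ℂ H] :
    -- some choice of symmetry operators gives a non-empty class iff `n = 2m` and `N = 4m`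
    (∀ d n : ℕ,
      (∃ T C : H ≃ₗᵢ⋆[ℂ] H, ClassDIII.IsDIIIPair T C ∧ (ClassDIII.DIII T C d n).Nonempty) ↔
        ∃ m : ℕ, n = 2 * m ∧ Module.finrank ℂ H = 4 * m) ∧
    ∀ T C : H ≃ₗᵢ⋆[ℂ] H, ClassDIII.IsDIIIPair T C →
      -- the same for each choice of the symmetry operators
      (∀ d n : ℕ, (ClassDIII.DIII T C d n).Nonempty ↔
        ∃ m : ℕ, n = 2 * m ∧ Module.finrank ℂ H = 4 * m) ∧
      ∀ m : ℕ, Module.finrank ℂ H = 4 * m →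
        -- the normal form exists
        (∃ b : OrthonormalBasis (ClassDIII.Idx m) ℂ H, ClassDIII.IsNormalBasis T C b) ∧
        -- in a basis of normal form, `P(k) = ½ [1, Q(k); Q(k)^*, 1]` with `Q(k)` unitary
        (∀ b : OrthonormalBasis (ClassDIII.Idx m) ℂ H, ClassDIII.IsNormalBasis T C b →
          ∀ (d : ℕ), ∀ P ∈ ClassDIII.DIII T C d (2 * m), ∀ k : ClassDIII.Torus d,
            ClassDIII.matQ b (P k) ∈ Matrix.unitaryGroup (Fin m ⊕ Fin m) ℂ ∧
            LinearMap.toMatrix b.toBasis b.toBasis (P k : H →ₗ[ℂ] H) =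
              (1 / 2 : ℂ) • Matrix.fromBlocks 1 (ClassDIII.matQ b (P k))
                (ClassDIII.matQ b (P k))ᴴ 1) ∧
        -- `d = 0`: path-connectedness and the identification with `U(2m) / Sp(m)`
        IsPathConnected (ClassDIII.DIII T C 0 (2 * m)) ∧
        (∀ b : OrthonormalBasis (ClassDIII.Idx m) ℂ H, ClassDIII.IsNormalBasis T C b →
          ∃ φ : (ClassDIII.U m ⧸ ClassDIII.Sp m) ≃ₜ ClassDIII.DIII T C 0 (2 * m),
            ∀ V : ClassDIII.U m,
              ClassDIII.matA b ((φ (QuotientGroup.mk V)).1 0) =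
                ((V⁻¹ : ClassDIII.U m) :
                    Matrix (Fin m ⊕ Fin m) (Fin m ⊕ Fin m) ℂ)ᵀ * ClassDIII.J m *
                  ((V⁻¹ : ClassDIII.U m) : Matrix (Fin m ⊕ Fin m) (Fin m ⊕ Fin m) ℂ)) ∧
        -- `d = 1`: the index, its formula, and the classification up to homotopy
        ∃ Index : ClassDIII.DIII T C 1 (2 * m) → ℤˣ,
          (∀ b : OrthonormalBasis (ClassDIII.Idx m) ℂ H, ClassDIII.IsNormalBasis T C b →
            ∀ P : ClassDIII.DIII T C 1 (2 * m),
              (∃ α : ℝ → ℝ, ClassDIII.IsPhase b P.1 α) ∧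
              ∀ α : ℝ → ℝ, ClassDIII.IsPhase b P.1 α →
                (((Index P : ℤˣ) : ℤ) : ℂ) = ClassDIII.indexFormula b P.1 α) ∧
          ∀ P₀ P₁ : ClassDIII.DIII T C 1 (2 * m),
            JoinedIn (ClassDIII.DIII T C 1 (2 * m)) P₀.1 P₁.1 ↔ Index P₀ = Index P₁ := by
  refine ⟨fun d n => ⟨?_, ?_⟩, fun T C h => ⟨fun d n => ⟨?_, ?_⟩, fun m hm => ?_⟩⟩
  · rintro ⟨T, C, h, hne⟩
    exact ClassDIII.exists_dim_of_mem_DIII h hne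
  · rintro ⟨m, rfl, hm⟩
    obtain ⟨T, C, h⟩ := ClassDIII.exists_isDIIIPair hm
    exact ⟨T, C, h, ClassDIII.nonempty_DIII h hm d⟩
  · exact ClassDIII.exists_dim_of_mem_DIII h
  · rintro ⟨m, rfl, hm⟩
    exact ClassDIII.nonempty_DIII h hm d
  · obtain ⟨b, hb⟩ := ClassDIII.exists_isNormalBasis h hm
    refine ⟨⟨b, hb⟩, fun b hb d P hP k => ?_, ClassDIII.isPathConnected_DIII_zero hb,
      fun b hb => ?_, ClassDIII.exists_index hb⟩
    · obtain ⟨hu, -, hA⟩ := ClassDIII.matA_mem hb hP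
      rw [hA, ClassDIII.matQ_of_toMatrix (hA k)]
      exact ⟨mul_mem (ClassDIII.J_mem_unitary m) (hu k), rfl⟩
    · refine ⟨(ClassDIII.homeoQuotient m).trans (ClassDIII.homeoSymFam hb 0).symm, fun V => ?_⟩
      exact ClassDIII.matA_homeoSymFam_symm hb _ _
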